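/- Let $\mathbb{Z}^2$ be equipped with its nearest-neighbour graph structure, with set $E_2$ of unoriented edges, and let $Q$ be a probability measure on environments $\omega : E_2 \to [0,\infty)$ under which the conductances $(\omega(e))_{e\in E_2}$ are independent and identically distributed, with $Q(\omega(e)>0)=1$ and, for some constant $M<\infty$, $Q(\omega(e)\le M)=1$. For an environment $\omega$ write $m^\omega(x)=\sum_{z\sim x}\omega(x,z)$ for $x \in \mathbb{Z}^2$ and $m^\omega(B)=\sum_{x\in B}m^\omega(x)$ for $B\subset\mathbb{Z}^2$. Let $(X_k)_{k\ge 0}$ be the discrete-time random walk on $\mathbb{Z}^2$ started at $0$ with transition probabilities $p^\omega(x,y)=\omega(x,y)/m^\omega(x)$ for $y \sim x$, with expectation denoted $\mathbb{E}_0^\omega$, and let $\tau_B=\inf\{k\ge 0 : X_k\notin B\}$ be its exit time from $B$. Then there is a constant $C=C(Q)\in(0,\infty)$ such that for $Q$-almost every $\omega$ there is $N(\omega)<\infty$ such that every connected set $B\subset\mathbb{Z}^2$ with $0\in B$ and $m^\omega(B)\ge N(\omega)$ satisfies $$\mathbb{E}_0^\omega(\tau_B)\le C\, m^\omega(B).$$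 (Both sides take values in $[0,\infty]$; when $m^\omega(B)=\infty$ the inequality is trivial.) -/

import Mathlib

open MeasureTheory ProbabilityTheory
open scoped NNReal ENNReal

/-- The nearest-neighbour graph on `ℤ^d`: `x ∼ y` iff their `ℓ¹`-distance is `1`. -/
def latticeGraph (d : ℕ) : SimpleGraph (Fin d → ℤ) where
  Adj x y := ∑ i, |x i - y i| = 1
  symm := ⟨fun x y h => by simpa only [abs_sub_comm] using h⟩
  loopless := ⟨fun x h => by simp at h⟩

/-- An environment assigns a nonnegative conductance to every unoriented edge of `ℤ^d`.
It carries the product `σ`-algebra. -/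
abbrev Environment (d : ℕ) : Type := (latticeGraph d).edgeSet → ℝ≥0

open Classical in
/-- The (symmetric) conductance `ω(x,y)`, extended by `0` to pairs that are not edges. -/
noncomputable def conductance {d : ℕ} (ω : Environment d) (x y : Fin d → ℤ) : ℝ≥0 :=
  if h : (latticeGraph d).Adj x y then ω ⟨s(x, y), h⟩ else 0

/-- The reversible measure at a vertex: `m^ω(x) = ∑_{z ∼ x} ω(x,z)`. -/
noncomputable def vertexWeight {d : ℕ} (ω : Environment d) (x : Fin d → ℤ) : ℝ≥0∞ :=
  ∑' y, (conductance ω x y : ℝ≥0∞)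

/-- The volume `m^ω(B) = ∑_{x ∈ B} m^ω(x)` of a set of vertices. -/
noncomputable def volumeOf {d : ℕ} (ω : Environment d) (B : Set (Fin d → ℤ)) : ℝ≥0∞ :=
  ∑' x : B, vertexWeight ω x

/-- Every vertex has finitely many neighbours. -/
lemma latticeGraph_finite_neighbors {d : ℕ} (x : Fin d → ℤ) :
    {y | (latticeGraph d).Adj x y}.Finite := by
  refine (Set.finite_Icc (x - 1) (x + 1)).subset fun y hy => ?_
  have hy' : ∑ i, |x i - y i| = 1 := hy
  have h : ∀ i, |x i - y i| ≤ 1 := fun i => hy' ▸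
    Finset.single_le_sum (f := fun i => |x i - y i|) (fun j _ => abs_nonneg _) (Finset.mem_univ i)
  constructor <;> intro i <;> have := abs_le.1 (h i) <;> simp <;> omega

/-- The weight of a vertex is finite. -/
lemma vertexWeight_ne_top {d : ℕ} (ω : Environment d) (x : Fin d → ℤ) :
    vertexWeight ω x ≠ ∞ := by
  unfold vertexWeight
  rw [tsum_eq_sum (s := (latticeGraph_finite_neighbors x).toFinset)]
  · exact ENNReal.sum_ne_top.2 fun _ _ => ENNReal.coe_ne_top
  · intro y hy
    have : ¬ (latticeGraph d).Adj x y := by simpa using hy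
    simp [conductance, this]

open Classical in
/-- One step of the walk from `x`: it goes to `y` with probability
`p^ω(x,y) = ω(x,y) / m^ω(x)`. At a vertex of weight `0`, where the quotient is meaningless,
the walk stays put; when all conductances are positive there is no such vertex for `d ≥ 1`. -/
noncomputable def stepPMF {d : ℕ} (ω : Environment d) (x : Fin d → ℤ) : PMF (Fin d → ℤ) :=
  if h : vertexWeight ω x = 0 then PMF.pure x
  else PMF.normalize (fun y => (conductance ω x y : ℝ≥0∞))
    (by rwa [vertexWeight] at h) (by have := vertexWeight_ne_top ω x; rwa [vertexWeight] at this)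

/-- The transition kernel of the walk. -/
noncomputable def stepKernel {d : ℕ} (ω : Environment d) :
    Kernel (Fin d → ℤ) (Fin d → ℤ) where
  toFun x := (stepPMF ω x).toMeasure
  measurable' := measurable_of_countable _

instance {d : ℕ} (ω : Environment d) : IsMarkovKernel (stepKernel ω) :=
  ⟨fun x => inferInstanceAs (IsProbabilityMeasure (stepPMF ω x).toMeasure)⟩

/-- The kernel giving the law of `X_{n+1}` from the past `X_0, …, X_n`; it depends on `X_n` only. -/
noncomputable def historyKernel {d : ℕ} (ω : Environment d) (n : ℕ) :
    Kernel ((i : Finset.Iic n) → (fun _ : ℕ => Fin d → ℤ) i) (Fin d → ℤ) :=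
  (stepKernel ω).comap (fun h => h ⟨n, Finset.mem_Iic.2 le_rfl⟩) (measurable_pi_apply _)

instance {d : ℕ} (ω : Environment d) (n : ℕ) : IsMarkovKernel (historyKernel ω n) := by
  unfold historyKernel; infer_instance

/-- The law `P_x^ω` on trajectories of the walk started at `x`. -/
noncomputable def walkLaw {d : ℕ} (ω : Environment d) (x : Fin d → ℤ) :
    Measure (ℕ → Fin d → ℤ) :=
  Kernel.traj (X := fun _ : ℕ => Fin d → ℤ) (historyKernel ω) 0 (fun _ => x)

/-- The exit time `τ_B = inf {k ≥ 0 : X_k ∉ B}`, equal to `∞` if the trajectory stays in `B`. -/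
noncomputable def exitTime {d : ℕ} (B : Set (Fin d → ℤ)) (X : ℕ → Fin d → ℤ) : ℝ≥0∞ :=
  ⨅ (k : ℕ) (_ : X k ∉ B), (k : ℝ≥0∞)

/-- The expected exit time `E_x^ω(τ_B)`. -/
noncomputable def expectedExitTime {d : ℕ} (ω : Environment d) (x : Fin d → ℤ)
    (B : Set (Fin d → ℤ)) : ℝ≥0∞ :=
  ∫⁻ X, exitTime B X ∂(walkLaw ω x)

/-! The expected exit time is the sum over `B` of m(x) g(x), where g is the Green function from 0 of
the walk killed outside `B`, as a density with respect to m. It suffices to show that the level sets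
{g > t} lose half of their volume each time t grows by a fixed amount.

Isoperimetry (`ae_isoperimetric`). Conductances may be arbitrarily small, so no inequality holds at
all scales. The outer boundary of a finite connected set A containing 0 is, however, a
plaquette-connected contour S with |A| ≤ |S|² (`exists_contour`). There are at most exponentially
many contours of given size near 0, and a Chernoff bound with an arbitrarily good rate
(`exists_measure_sum_le_pow`) beats this entropy. By Borel–Cantelli all large contours carry
conductance at least δ|S|, hence |A| ≤ K cut(A)² for all large A.

Level sets. By the maximum principle {g > t} contains 0 and is connected, so the inequality applies
to it when it is large. The clip of g between t and t + s has energy at most 2s (`energy_le`). The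
coarea formula and Cauchy–Schwarz then bound s b² by twice the volume of {g > t}, where b is a lower
bound for the cuts in between (`cut_sq_le`). With s a multiple of K and of the bound on m, the
volume halves, and a geometric series gives a bound linear in m(B) (`sum_le`).

Small level sets miss a vertex on a fixed path from 0, whose conductances bound g(0) - t
(`sub_le_of_path`). This costs an additive constant depending on ω, absorbed by N(ω). -/

/-! ### Connectedness through cuts -/

/-- A set is connected for a relation `r` if every proper nonempty subset is joined by `r`
to its complement in the set. -/
def CutConnected {α : Type*} (r : α → α → Prop) (S : Set α) : Prop :=
  ∀ T ⊆ S, T.Nonempty → T ≠ S → ∃ x ∈ T, ∃ y ∈ S, y ∉ T ∧ r x y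

/-- No related pair leaves the level set of `φ` through `x`, so this level set is all of `S`. -/
lemma CutConnected.const {α β : Type*} {r : α → α → Prop} {S : Set α} (hS : CutConnected r S)
    {φ : α → β} (hφ : ∀ x ∈ S, ∀ y ∈ S, r x y → φ x = φ y) {x y : α} (hx : x ∈ S) (hy : y ∈ S) :
    φ x = φ y := by
  by_contra hne
  obtain ⟨a, ha, b, hb, hbT, hab⟩ := hS {z | z ∈ S ∧ φ z = φ x} (fun z hz => hz.1) ⟨x, hx, rfl⟩
    (fun h => hne (by rw [← h] at hy; exact hy.2.symm))
  exact hbT ⟨hb, (hφ a ha.1 b hb hab).symm.trans ha.2⟩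

lemma CutConnected.insert_of_adj {α : Type*} {r : α → α → Prop} (hr : ∀ x y, r x y → r y x) {S : Set α}
    (hS : CutConnected r S) {x y : α} (hx : x ∈ S) (hxy : r x y) :
    CutConnected r (insert y S) := by
  intro T hT hne hTS
  by_cases h1 : (T ∩ S).Nonempty
  · by_cases h2 : T ∩ S = S
    · have hST : S ⊆ T := Set.inter_eq_right.1 h2
      refine ⟨x, hST hx, y, Set.mem_insert _ _, fun hy => hTS ?_, hxy⟩
      exact hT.antisymm (Set.insert_subset hy hST)
    · obtain ⟨a, ha, b, hb, hbT, hab⟩ := hS _ Set.inter_subset_right h1 h2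
      exact ⟨a, ha.1, b, Set.mem_insert_of_mem _ hb, fun h => hbT ⟨h, hb⟩, hab⟩
  · obtain ⟨z, hz⟩ := hne
    have hTy : ∀ z ∈ T, z = y := fun z hz =>
      (hT hz).resolve_right fun h => h1 ⟨z, hz, h⟩
    have hyT : y ∈ T := hTy z hz ▸ hz
    exact ⟨y, hyT, x, Set.mem_insert_of_mem _ hx, fun h => h1 ⟨x, h, hx⟩, hr _ _ hxy⟩

lemma cutConnected_singleton {α : Type*} (r : α → α → Prop) (x : α) :
    CutConnected r {x} := by
  intro T hT hne hTS
  rcases Set.subset_singleton_iff_eq.1 hT with h | h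
  · exact absurd h hne.ne_empty
  · exact absurd h hTS

/-- A set inducing a connected subgraph is connected in the sense of cuts. -/
lemma cutConnected_of_induce {α : Type*} {G : SimpleGraph α} {S : Set α}
    (h : (G.induce S).Connected) : CutConnected G.Adj S := by
  intro T hT ⟨x, hx⟩ hTS
  obtain ⟨y, hy, hyT⟩ := Set.exists_of_ssubset (hT.ssubset_of_ne hTS)
  obtain ⟨p⟩ := h.preconnected ⟨x, hT hx⟩ ⟨y, hy⟩
  obtain ⟨d, -, h1, h2⟩ := p.exists_boundary_dart {z : S | (z : α) ∈ T} hx hyT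
  exact ⟨_, h1, _, d.snd.2, h2, d.adj⟩

/-- A connected infinite set contains finite connected sets of every positive size. -/
lemma CutConnected.exists_finset {α : Type*} [DecidableEq α] {r : α → α → Prop}
    (hr : ∀ x y, r x y → r y x) {S : Set α}
    (hS : CutConnected r S) (hinf : S.Infinite) {x : α} (hx : x ∈ S) (n : ℕ) :
    ∃ A : Finset α, (A : Set α) ⊆ S ∧ x ∈ A ∧ CutConnected r A ∧ A.card = n + 1 := by
  induction n with
  | zero => exact ⟨{x}, by simpa using hx, by simp, by simpa using cutConnected_singleton r x,
      by simp⟩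
  | succ n ih =>
    obtain ⟨A, hAS, hxA, hA, hcard⟩ := ih
    obtain ⟨a, ha, b, hb, hbA, hab⟩ := hS A hAS ⟨x, hxA⟩
      (fun h => hinf (h ▸ A.finite_toSet))
    refine ⟨insert b A, ?_, Finset.mem_insert_of_mem hxA, ?_, ?_⟩
    · rw [Finset.coe_insert]; exact Set.insert_subset hb hAS
    · rw [Finset.coe_insert]; exact hA.insert_of_adj hr ha hab
    · rw [Finset.card_insert_of_notMem (by simpa using hbA), hcard]

/-! ### Discrete Poincaré lemma on the square lattice -/

/-- The `b`-th unit vector of `ℤ²`. -/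
abbrev unitVec (b : Fin 2) : Fin 2 → ℤ := Pi.single b 1

lemma latticeGraph_adj_iff {x y : Fin 2 → ℤ} :
    (latticeGraph 2).Adj x y ↔ ∃ b, y = x + unitVec b ∨ x = y + unitVec b := by
  have h0 : (latticeGraph 2).Adj x y ↔ |x 0 - y 0| + |x 1 - y 1| = 1 := by
    change ∑ i, |x i - y i| = 1 ↔ _
    rw [Fin.sum_univ_two]
  rw [h0]
  simp only [Fin.exists_fin_two, funext_iff, Fin.forall_fin_two, Pi.add_apply, Pi.single_apply]
  simp only [abs_eq_max_neg]
  simp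
  omega

lemma latticeGraph_adj_add (x : Fin 2 → ℤ) (b : Fin 2) :
    (latticeGraph 2).Adj x (x + unitVec b) :=
  latticeGraph_adj_iff.2 ⟨b, Or.inl rfl⟩

/-- Every function on `ℤ` has a discrete primitive. -/
lemma exists_int_primitive {G : Type*} [AddCommGroup G] (a : ℤ → G) :
    ∃ F : ℤ → G, ∀ z, F (z + 1) - F z = a z := by
  refine ⟨fun z => (∑ i ∈ Finset.range z.toNat, a i) - ∑ i ∈ Finset.range (-z).toNat, a (-i - 1),
    fun z => ?_⟩
  obtain ⟨n, rfl | rfl⟩ := z.eq_nat_or_neg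
  · have h1 : ((n : ℤ) + 1).toNat = n + 1 := by omega
    have h2 : (-((n : ℤ) + 1)).toNat = 0 := by omega
    have h3 : (-(n : ℤ)).toNat = 0 := by omega
    simp only [h1, h2, h3, Int.toNat_natCast, Finset.sum_range_succ]
    simp
  · rcases n with _ | n
    · simp
    · have h1 : (-((n + 1 : ℕ) : ℤ) + 1).toNat = 0 := by omega
      have h2 : (-(-((n + 1 : ℕ) : ℤ) + 1)).toNat = n := by omega
      have h3 : (- -((n + 1 : ℕ) : ℤ)).toNat = n + 1 := by omega
      have h4 : (-((n + 1 : ℕ) : ℤ)).toNat = 0 := by omega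
      simp only [h1, h2, h3, h4, Finset.sum_range_succ]
      have : (-((n + 1 : ℕ) : ℤ)) = -(n : ℤ) - 1 := by push_cast; ring
      rw [this]; simp

lemma int_const_of_step {β : Type*} {F : ℤ → β} (h : ∀ z, F (z + 1) = F z) (a b : ℤ) :
    F a = F b := by
  suffices ∀ z, F z = F 0 by rw [this a, this b]
  intro z
  induction z using Int.induction_on with
  | zero => rfl
  | succ i ih => rw [h, ih]
  | pred i ih => rw [← ih, ← h (-i - 1)]; simp

lemma vec_add_unitVec_zero (x y : ℤ) : ![x, y] + unitVec 0 = ![x + 1, y] := by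
  ext i; fin_cases i <;> simp

lemma vec_add_unitVec_one (x y : ℤ) : ![x, y] + unitVec 1 = ![x, y + 1] := by
  ext i; fin_cases i <;> simp

/-- The Poincaré lemma on `ℤ²`: a closed `1`-cochain is a gradient. -/
lemma exists_potential {G : Type*} [AddCommGroup G] (f : (Fin 2 → ℤ) × Fin 2 → G)
    (hf : ∀ p, f (p, 0) + f (p + unitVec 0, 1) = f (p, 1) + f (p + unitVec 1, 0)) :
    ∃ φ : (Fin 2 → ℤ) → G, ∀ p b, f (p, b) = φ (p + unitVec b) - φ p := by
  obtain ⟨H, hH⟩ := exists_int_primitive fun x => f (![x, 0], 0)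
  choose V hV using fun x => exists_int_primitive fun y => f (![x, y], 1)
  have hvert : ∀ x y, f (![x, y], 1) = V x (y + 1) - V x y := fun x y => (hV x y).symm
  have key : ∀ x y, f (![x, y], 0) =
      (H (x + 1) + (V (x + 1) y - V (x + 1) 0)) - (H x + (V x y - V x 0)) := by
    intro x y
    -- Closedness on unit squares makes this difference independent of the height; at height 0 it is
    -- expressed through the increment of `H`.
    have h := int_const_of_step
      (F := fun y => f (![x, y], 0) - (V (x + 1) y - V x y)) (fun z => ?_) y 0
    · rw [sub_eq_iff_eq_add] at h
      rw [h, ← hH x]; abel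
    · have := hf ![x, z]
      rw [vec_add_unitVec_zero, vec_add_unitVec_one, hvert, hvert, ← sub_eq_iff_eq_add'] at this
      rw [← this]; abel
  refine ⟨fun p => H (p 0) + (V (p 0) (p 1) - V (p 0) 0), fun p b => ?_⟩
  obtain ⟨x, y, rfl⟩ : ∃ x y, p = ![x, y] := ⟨p 0, p 1, by ext i; fin_cases i <;> rfl⟩
  fin_cases b
  · simp only [Fin.zero_eta, vec_add_unitVec_zero]
    simpa using key x y
  · simp only [Fin.mk_one, vec_add_unitVec_one]
    simp [hvert]

/-! ### Contours around finite connected sets -/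

/-- The four edges of the unit square with lower left corner `q`; the pair `(p, b)` stands for
the edge from `p` to `p + unitVec b`. -/
def plaquette (q : Fin 2 → ℤ) : Fin 4 → (Fin 2 → ℤ) × Fin 2 :=
  ![(q, 0), (q, 1), (q + unitVec 0, 1), (q + unitVec 1, 0)]

/-- Two edges are neighbours if they lie on a common plaquette. -/
def SharePlaquette (x y : (Fin 2 → ℤ) × Fin 2) : Prop :=
  ∃ q i j, x = plaquette q i ∧ y = plaquette q j

/-- The edges with exactly one endpoint in `U`. -/
def edgeBoundary (U : Set (Fin 2 → ℤ)) : Set ((Fin 2 → ℤ) × Fin 2) :=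
  {w | ¬(w.1 ∈ U ↔ w.1 + unitVec w.2 ∈ U)}

/-- A boundary between two connected regions is connected through plaquettes. -/
lemma cutConnected_edgeBoundary {A U : Set (Fin 2 → ℤ)}
    (hA : CutConnected (latticeGraph 2).Adj A)
    (hAU : ∀ x ∈ A, x ∉ U)
    (hbd : ∀ x y, (latticeGraph 2).Adj x y → x ∈ U → y ∉ U → y ∈ A)
    (hU : ∀ φ : (Fin 2 → ℤ) → ZMod 2,
      (∀ x y, (latticeGraph 2).Adj x y → x ∈ U → y ∈ U → φ x = φ y) →
      ∀ x ∈ U, ∀ y ∈ U, φ x = φ y) :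
    CutConnected SharePlaquette (edgeBoundary U) := by
  classical
  intro T hT hne hTS
  by_contra hcon
  push Not at hcon
  -- The indicator of `T` modulo 2 is closed: a plaquette meeting `T` has all its boundary edges in
  -- `T`, and their number is even. Otherwise it contributes only zeros.
  let f : (Fin 2 → ℤ) × Fin 2 → ZMod 2 := fun w => if w ∈ T then 1 else 0
  have hfc : ∀ p, f (p, 0) + f (p + unitVec 0, 1) = f (p, 1) + f (p + unitVec 1, 0) := by
    intro p
    by_cases hp : ∃ i, plaquette p i ∈ T
    · obtain ⟨i, hi⟩ := hp
      have hj : ∀ j, plaquette p j ∈ T ↔ plaquette p j ∈ edgeBoundary U := by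
        intro j
        refine ⟨fun h => hT h, fun h => ?_⟩
        by_contra hj
        exact hcon _ hi _ h hj ⟨p, i, j, rfl, rfl⟩
      have h0 := hj 0
      have h1 := hj 1
      have h2 := hj 2
      have h3 := hj 3
      have hc : p + unitVec 1 + unitVec 0 = p + unitVec 0 + unitVec 1 := by
        rw [add_right_comm]
      simp only [plaquette, Matrix.cons_val_zero, Matrix.cons_val_one, Matrix.cons_val,
        edgeBoundary, Set.mem_ofPred_eq] at h0 h1 h2 h3
      rw [hc] at h3
      simp only [f, h0, h1, h2, h3]
      by_cases a0 : p ∈ U <;> by_cases a1 : p + unitVec 0 ∈ U <;>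
        by_cases a2 : p + unitVec 1 ∈ U <;>
        by_cases a3 : p + unitVec 0 + unitVec 1 ∈ U <;> simp only [a0, a1, a2, a3] <;> decide
    · push Not at hp
      have h0 := hp 0
      have h1 := hp 1
      have h2 := hp 2
      have h3 := hp 3
      simp only [plaquette, Matrix.cons_val_zero, Matrix.cons_val_one, Matrix.cons_val]
        at h0 h1 h2 h3
      simp [f, h0, h1, h2, h3]
  obtain ⟨φ, hφ⟩ := exists_potential f hfc
  have hstep : ∀ x y, (latticeGraph 2).Adj x y → (x ∈ U ↔ y ∈ U) → φ x = φ y := by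
    intro x y hxy hiff
    obtain ⟨b, rfl | rfl⟩ := latticeGraph_adj_iff.1 hxy
    · have h0 : f (x, b) = 0 := if_neg fun h => hT h hiff
      rw [hφ, sub_eq_zero] at h0
      exact h0.symm
    · have h0 : f (y, b) = 0 := if_neg fun h => hT h hiff.symm
      rw [hφ, sub_eq_zero] at h0
      exact h0
  have hcA : ∀ x ∈ A, ∀ y ∈ A, φ x = φ y := fun x hx y hy =>
    hA.const (fun a ha b hb hab => hstep a b hab (by simp [hAU a ha, hAU b hb])) hx hy
  have hcU := hU φ fun x y hxy hx hy => hstep x y hxy (by simp [hx, hy])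
  -- Every boundary edge joins `U` to `A`, and the potential is constant on each. So `f` is constant
  -- on the boundary, although it is 1 on `T` and 0 off it.
  have hends : ∀ w ∈ edgeBoundary U, ∃ a ∈ A, ∃ u ∈ U, f w = φ a - φ u := by
    rintro ⟨p, b⟩ hw
    have hadj := latticeGraph_adj_add p b
    have hw' : ¬(p ∈ U ↔ p + unitVec b ∈ U) := hw
    by_cases hp : p ∈ U
    · have hq : p + unitVec b ∉ U := fun h => hw' (by simp [hp, h])
      exact ⟨_, hbd _ _ hadj hp hq, _, hp, hφ p b⟩
    · have hq : p + unitVec b ∈ U := by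
        by_contra h; exact hw' (by simp [hp, h])
      refine ⟨_, hbd _ _ hadj.symm hq hp, _, hq, ?_⟩
      rw [hφ, CharTwo.sub_eq_add, CharTwo.sub_eq_add, add_comm]
  obtain ⟨w, hw⟩ := hne
  obtain ⟨w', hw', hw'T⟩ := Set.exists_of_ssubset (hT.ssubset_of_ne hTS)
  obtain ⟨a, ha, u, hu, h1⟩ := hends w (hT hw)
  obtain ⟨a', ha', u', hu', h2⟩ := hends w' hw'
  rw [← hcA a ha a' ha', ← hcU u hu u' hu', ← h1] at h2
  simp [f, hw, hw'T] at h2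

/-- A finite connected set containing the origin is surrounded by a plaquette-connected set of
edges, each of which leaves the set; the set of edges crosses the positive first axis near the
origin and its square dominates the size of the set. -/
lemma exists_contour (A : Finset (Fin 2 → ℤ)) (h0 : 0 ∈ A)
    (hA : CutConnected (latticeGraph 2).Adj (A : Set (Fin 2 → ℤ))) :
    ∃ S : Finset ((Fin 2 → ℤ) × Fin 2),
      CutConnected SharePlaquette (S : Set ((Fin 2 → ℤ) × Fin 2)) ∧
      (∃ j : ℕ, j < S.card ∧ (![(j : ℤ), 0], 0) ∈ S) ∧ A.card ≤ S.card ^ 2 ∧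
      ∀ w ∈ S, (w.1 ∈ A ∧ w.1 + unitVec w.2 ∉ A) ∨ (w.1 ∉ A ∧ w.1 + unitVec w.2 ∈ A) := by
  classical
  have hvec : ∀ x : Fin 2 → ℤ, ![x 0, x 1] = x := fun x => by ext i; fin_cases i <;> rfl
  obtain ⟨n, hn⟩ : ∃ n : ℤ, ∀ x ∈ A, ∀ i, |x i| ≤ n := by
    refine ⟨∑ x ∈ A, ∑ i, |x i|, fun x hx i => ?_⟩
    calc |x i| ≤ ∑ i, |x i| :=
          Finset.single_le_sum (f := fun i => |x i|) (fun _ _ => abs_nonneg _) (Finset.mem_univ i)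
      _ ≤ _ := Finset.single_le_sum (f := fun x : Fin 2 → ℤ => ∑ i, |x i|)
          (fun _ _ => Finset.sum_nonneg fun _ _ => abs_nonneg _) hx
  have hn0 : 0 ≤ n := (abs_nonneg _).trans (hn 0 h0 0)
  have hout : ∀ x : Fin 2 → ℤ, ∀ i, n < |x i| → x ∉ A := fun x i hx hxA =>
    absurd (hn x hxA i) (not_le.2 hx)
  have habs : n < |n + 1| := by rw [abs_of_nonneg (by omega)]; omega
  -- `U` is the component of this far corner in the complement of `A`. It contains everything
  -- outside the box of radius `n`, and its edge boundary is the contour.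
  set p₀ : Fin 2 → ℤ := ![n + 1, n + 1] with hp₀
  set U : Set (Fin 2 → ℤ) :=
    {x | Relation.ReflTransGen (fun a b => (latticeGraph 2).Adj a b ∧ b ∉ A) p₀ x} with hUdef
  have hp₀U : p₀ ∈ U := Relation.ReflTransGen.refl
  have hUA : ∀ x ∈ U, x ∉ A := by
    intro x hx
    rcases Relation.ReflTransGen.cases_tail hx with h | ⟨y, -, h⟩
    · rw [h]; exact hout p₀ 0 (by simpa [hp₀] using habs)
    · exact h.2
  have hUstep : ∀ x y, (latticeGraph 2).Adj x y → x ∈ U → y ∉ A → y ∈ U := fun x y hxy hx hy =>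
    Relation.ReflTransGen.tail hx ⟨hxy, hy⟩
  have hUconst : ∀ φ : (Fin 2 → ℤ) → ZMod 2,
      (∀ x y, (latticeGraph 2).Adj x y → x ∈ U → y ∈ U → φ x = φ y) →
      ∀ x ∈ U, ∀ y ∈ U, φ x = φ y := by
    intro φ hφ
    suffices ∀ x ∈ U, φ p₀ = φ x from fun x hx y hy => (this x hx).symm.trans (this y hy)
    intro x hx
    induction hx with
    | refl => rfl
    | tail hb hbc ih => exact ih.trans (hφ _ _ hbc.1 hb (Relation.ReflTransGen.tail hb hbc))
  have hiff : ∀ x b, x ∉ A → x + unitVec b ∉ A → (x + unitVec b ∈ U ↔ x ∈ U) := fun x b h1 h2 =>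
    ⟨fun h => hUstep _ _ (latticeGraph_adj_add x b).symm h h1,
      fun h => hUstep _ _ (latticeGraph_adj_add x b) h h2⟩
  have hcol : ∀ x, n < |x| → ∀ a b : ℤ, (![x, a] ∈ U ↔ ![x, b] ∈ U) := by
    intro x hx a b
    refine Iff.of_eq (int_const_of_step (F := fun z => ![x, z] ∈ U) (fun z => propext ?_) a b)
    rw [← vec_add_unitVec_one]
    exact hiff _ _ (hout _ 0 (by simpa using hx)) (hout _ 0 (by simpa using hx))
  have hrow : ∀ y, n < |y| → ∀ a b : ℤ, (![a, y] ∈ U ↔ ![b, y] ∈ U) := by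
    intro y hy a b
    refine Iff.of_eq (int_const_of_step (F := fun z => ![z, y] ∈ U) (fun z => propext ?_) a b)
    rw [← vec_add_unitVec_zero]
    exact hiff _ _ (hout _ 1 (by simpa using hy)) (hout _ 1 (by simpa using hy))
  have hbox0 : ∀ x y, n < |x| → ![x, y] ∈ U := fun x y hx =>
    (hcol x hx y (n + 1)).2 ((hrow _ habs x (n + 1)).2 hp₀U)
  have hbox1 : ∀ x y, n < |y| → ![x, y] ∈ U := fun x y hy =>
    (hrow y hy x (n + 1)).2 ((hcol _ habs y (n + 1)).2 hp₀U)
  have hAU : ∀ x ∈ A, x ∉ U := fun x hx h => hUA x h hx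
  have hbd : ∀ x y, (latticeGraph 2).Adj x y → x ∈ U → y ∉ U → y ∈ A := fun x y hxy hx hy => by
    by_contra h; exact hy (hUstep x y hxy hx h)
  have hends : ∀ w ∈ edgeBoundary U,
      (w.1 ∈ A ∧ w.1 + unitVec w.2 ∉ A) ∨ (w.1 ∉ A ∧ w.1 + unitVec w.2 ∈ A) := by
    rintro ⟨p, b⟩ hw
    have hadj := latticeGraph_adj_add p b
    have hw' : ¬(p ∈ U ↔ p + unitVec b ∈ U) := hw
    by_cases hp : p ∈ U
    · have hq : p + unitVec b ∉ U := fun h => hw' (by simp [hp, h])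
      exact Or.inr ⟨hUA _ hp, hbd _ _ hadj hp hq⟩
    · have hq : p + unitVec b ∈ U := by
        by_contra h; exact hw' (by simp [hp, h])
      exact Or.inl ⟨hbd _ _ hadj.symm hq hp, hUA _ hq⟩
  have hfin : (edgeBoundary U).Finite := by
    refine (((A ×ˢ Finset.univ) ∪ (A ×ˢ Finset.univ).image
      (fun w : (Fin 2 → ℤ) × Fin 2 => (w.1 - unitVec w.2, w.2))).finite_toSet).subset ?_
    rintro ⟨p, b⟩ hw
    rcases hends _ hw with h | h
    · simp [h.1]
    · refine Finset.mem_coe.2 (Finset.mem_union_right _ (Finset.mem_image.2 ⟨(p + unitVec b, b), ?_, ?_⟩))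
      · simp [h.2]
      · simp
  set S := hfin.toFinset with hS
  have hmem : ∀ w, w ∈ S ↔ ¬(w.1 ∈ U ↔ w.1 + unitVec w.2 ∈ U) := fun w => by
    rw [hS, Set.Finite.mem_toFinset]; rfl
  -- Far up in the column lies `U`, so membership must change across some vertical edge of the
  -- column.
  have hcolS : ∀ x y, ![x, y] ∉ U → ∃ w ∈ S, w.1 0 = x := by
    intro x y hxy
    by_contra! hcon
    have h := int_const_of_step (F := fun z => ![x, z] ∈ U) (fun z => ?_) y (n + 1)
    · exact hxy (h.mpr (hbox1 _ _ habs))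
    · have h1 : (![x, z], 1) ∉ S := fun h => hcon _ h rfl
      rw [hmem, not_not] at h1
      simp only [vec_add_unitVec_one] at h1
      exact propext h1.symm
  have hrowS : ∀ x y, ![x, y] ∉ U → ∃ w ∈ S, w.1 1 = y := by
    intro x y hxy
    by_contra! hcon
    have h := int_const_of_step (F := fun z => ![z, y] ∈ U) (fun z => ?_) x (n + 1)
    · exact hxy (h.mpr (hbox0 _ _ habs))
    · have h1 : (![z, y], 0) ∉ S := fun h => hcon _ h rfl
      rw [hmem, not_not] at h1
      simp only [vec_add_unitVec_zero] at h1
      exact propext h1.symm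
  have hAvec : ∀ x ∈ A, ![x 0, x 1] ∉ U := fun x hx => by rw [hvec]; exact hAU x hx
  refine ⟨S, ?_, ?_, ?_, ?_⟩
  · rw [hS, Set.Finite.coe_toFinset]
    exact cutConnected_edgeBoundary hA (fun x hx => hAU x hx) hbd hUconst
  · have hex : ∃ j : ℕ, ![(j : ℤ) + 1, 0] ∈ U := by
      refine ⟨n.toNat, hbox0 _ _ ?_⟩
      rwa [Int.toNat_of_nonneg hn0]
    set j := Nat.find hex with hj
    have hjU : ![(j : ℤ) + 1, 0] ∈ U := Nat.find_spec hex
    have hlt : ∀ i : ℕ, i ≤ j → ![(i : ℤ), 0] ∉ U := by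
      intro i hi
      rcases i with _ | i
      · have := hAvec 0 h0
        simpa using this
      · have := Nat.find_min hex (show i < j by omega)
        simpa using this
    refine ⟨j, ?_, ?_⟩
    · have hsub : (Finset.range (j + 1)).image (fun i : ℕ => (i : ℤ)) ⊆ S.image (fun w => w.1 0) := by
        intro z hz
        obtain ⟨i, hi, rfl⟩ := Finset.mem_image.1 hz
        obtain ⟨w, hw, hwi⟩ := hcolS _ _ (hlt i (by simpa [Nat.lt_succ_iff] using hi))
        exact Finset.mem_image.2 ⟨w, hw, hwi⟩
      have hc := (Finset.card_le_card hsub).trans Finset.card_image_le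
      rw [Finset.card_image_of_injective _ Nat.cast_injective, Finset.card_range] at hc
      omega
    · rw [hmem]
      simp only [vec_add_unitVec_zero]
      intro h
      exact hlt j le_rfl (h.2 hjU)
  · calc A.card ≤ ((A.image (fun x => x 0)) ×ˢ (A.image (fun x => x 1))).card := by
          refine Finset.card_le_card_of_injOn (fun x => (x 0, x 1)) ?_ ?_
          · intro x hx
            simp only [Finset.coe_product, Finset.coe_image, Set.mem_prod]
            exact ⟨⟨x, hx, rfl⟩, ⟨x, hx, rfl⟩⟩
          · intro x _ y _ hxy
            obtain ⟨h1, h2⟩ := Prod.mk.inj hxy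
            rw [← hvec x, ← hvec y, h1, h2]
      _ = (A.image (fun x => x 0)).card * (A.image (fun x => x 1)).card := Finset.card_product _ _
      _ ≤ S.card * S.card := by
          gcongr
          · refine (Finset.card_le_card (t := S.image (fun w => w.1 0)) ?_).trans
              Finset.card_image_le
            intro z hz
            obtain ⟨x, hx, rfl⟩ := Finset.mem_image.1 hz
            obtain ⟨w, hw, h⟩ := hcolS _ _ (hAvec x hx)
            exact Finset.mem_image.2 ⟨w, hw, h⟩
          · refine (Finset.card_le_card (t := S.image (fun w => w.1 1)) ?_).trans
              Finset.card_image_le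
            intro z hz
            obtain ⟨x, hx, rfl⟩ := Finset.mem_image.1 hz
            obtain ⟨w, hw, h⟩ := hrowS _ _ (hAvec x hx)
            exact Finset.mem_image.2 ⟨w, hw, h⟩
      _ = S.card ^ 2 := (sq _).symm
  · intro w hw
    exact hends w (by rw [hS, Set.Finite.mem_toFinset] at hw; exact hw)

/-! ### Coding connected sets by walks -/

section Animals

variable {W ι : Type*} [DecidableEq W]

/-- The vertices visited by the walk from `w` that follows the successive directions in `c`. -/
def visited (nb : W → ι → W) : W → List ι → Finset W
  | w, [] => {w}
  | w, i :: c => insert w (visited nb (nb w i) c)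

lemma self_mem_visited (nb : W → ι → W) (w : W) (c : List ι) : w ∈ visited nb w c := by
  cases c <;> simp [visited]

/-- A walk can be lengthened by two steps to visit one more neighbour of a visited vertex. -/
lemma visited_detour (nb : W → ι → W) (c : List ι) (w : W) {x y : W} {i j : ι}
    (hx : x ∈ visited nb w c) (hy : nb x i = y) (hxy : nb y j = x) :
    ∃ c' : List ι, c'.length = c.length + 2 ∧ visited nb w c' = insert y (visited nb w c) := by
  have hself : ∀ c, ∃ c' : List ι, c'.length = c.length + 2 ∧
      visited nb x c' = insert y (visited nb x c) := fun c => by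
    refine ⟨i :: j :: c, rfl, ?_⟩
    simp only [visited, hy, hxy]
    rw [Finset.insert_comm, Finset.insert_eq_of_mem (self_mem_visited nb x c)]
  induction c generalizing w with
  | nil =>
    obtain rfl : x = w := by simpa [visited] using hx
    exact hself []
  | cons k c ih =>
    by_cases hxw : x = w
    · subst hxw; exact hself _
    · have hx' : x ∈ visited nb (nb w k) c := by
        simpa [visited, hxw] using hx
      obtain ⟨c', hc', hv⟩ := ih _ hx'
      refine ⟨k :: c', by simp [hc'], ?_⟩
      simp only [visited, hv]
      rw [Finset.insert_comm]

/-- A finite connected set is the range of a walk of length twice its size. -/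
lemma exists_visited_eq (nb : W → ι → W) {r : W → W → Prop}
    (hr : ∀ x y, r x y → (∃ i, nb x i = y) ∧ ∃ j, nb y j = x) {S : Finset W}
    (hS : CutConnected r (S : Set W)) {w : W} (hw : w ∈ S) :
    ∃ c : List ι, c.length = 2 * (S.card - 1) ∧ visited nb w c = S := by
  -- The visited set grows by one vertex at a time, each at the price of a two-step detour.
  suffices ∀ k < S.card, ∃ c : List ι, c.length = 2 * k ∧ (visited nb w c).card = k + 1 ∧
      visited nb w c ⊆ S by
    have hpos := Finset.card_pos.2 ⟨w, hw⟩
    obtain ⟨c, h1, h2, h3⟩ := this (S.card - 1) (by omega)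
    exact ⟨c, h1, Finset.eq_of_subset_of_card_le h3 (by omega)⟩
  intro k
  induction k with
  | zero => exact fun _ => ⟨[], rfl, by simp [visited], by simpa [visited] using hw⟩
  | succ k ih =>
    intro hk
    obtain ⟨c, h1, h2, h3⟩ := ih (by omega)
    obtain ⟨x, hx, y, hy, hyT, hxy⟩ := hS (visited nb w c : Set W) (Finset.coe_subset.2 h3)
      ⟨w, self_mem_visited nb w c⟩ (fun h => by rw [Finset.coe_inj.1 h] at h2; omega)
    obtain ⟨⟨i, hi⟩, ⟨j, hj⟩⟩ := hr x y hxy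
    obtain ⟨c', h1', h2'⟩ := visited_detour nb c w hx hi hj
    refine ⟨c', by omega, ?_, ?_⟩
    · rw [h2', Finset.card_insert_of_notMem (by simpa using hyT), h2]
    · rw [h2']; exact Finset.insert_subset hy h3

end Animals

/-- The edges that share a plaquette with a given edge, listed by one of the two plaquettes of the
edge and one of its four edges. -/
def edgeNeighbor (w : (Fin 2 → ℤ) × Fin 2) (i : Fin 2 × Fin 4) : (Fin 2 → ℤ) × Fin 2 :=
  plaquette (if i.1 = 0 then w.1 else w.1 - unitVec (1 - w.2)) i.2

/-- The bottom and left sides start at the corner of the plaquette; from the right and top sides it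
is reached by one step back, transversally to the edge. -/
lemma SharePlaquette.exists_edgeNeighbor {x y : (Fin 2 → ℤ) × Fin 2} (h : SharePlaquette x y) :
    (∃ i, edgeNeighbor x i = y) ∧ ∃ j, edgeNeighbor y j = x := by
  have key : ∀ q i, ∃ k : Fin 2,
      (if k = 0 then (plaquette q i).1 else (plaquette q i).1 - unitVec (1 - (plaquette q i).2))
        = q := by
    intro q i
    fin_cases i
    · exact ⟨0, rfl⟩
    · exact ⟨0, rfl⟩
    · exact ⟨1, by simp [plaquette]⟩
    · exact ⟨1, by simp [plaquette]⟩
  obtain ⟨q, i, j, rfl, rfl⟩ := h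
  obtain ⟨k, hk⟩ := key q i
  obtain ⟨l, hl⟩ := key q j
  exact ⟨⟨(k, j), by rw [edgeNeighbor, hk]⟩, ⟨(l, i), by rw [edgeNeighbor, hl]⟩⟩

/-! ### Large deviations and the isoperimetric inequality -/

/-- The Laplace transform of an almost surely positive variable vanishes at infinity. -/
lemma tendsto_mgf_neg_natCast {Ω : Type*} [MeasurableSpace Ω] {μ : Measure Ω} [IsFiniteMeasure μ]
    {X : Ω → ℝ} (hX : Measurable X) (hpos : ∀ᵐ x ∂μ, 0 < X x) :
    Filter.Tendsto (fun n : ℕ => mgf X μ (-(n : ℝ))) Filter.atTop (nhds 0) := by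
  have h := tendsto_integral_of_dominated_convergence (μ := μ)
    (F := fun (n : ℕ) x => Real.exp (-(n : ℝ) * X x)) (f := fun _ => (0 : ℝ)) (fun _ => (1 : ℝ))
    (fun n => (by fun_prop : Measurable fun x => Real.exp (-(n : ℝ) * X x)).aestronglyMeasurable)
    (integrable_const _) (fun n => ?_) ?_
  · simpa [mgf] using h
  · filter_upwards [hpos] with x hx
    rw [Real.norm_eq_abs, Real.abs_exp, Real.exp_le_one_iff]
    have : (0 : ℝ) ≤ n * X x := by positivity
    linarith
  · filter_upwards [hpos] with x hx
    refine Real.tendsto_exp_atBot.comp ?_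
    exact (Filter.tendsto_neg_atTop_atBot.comp tendsto_natCast_atTop_atTop).atBot_mul_const hx

/-- Sums of independent identically distributed positive variables are, with overwhelming
probability, at least a small multiple of the number of summands. -/
lemma exists_measure_sum_le_pow {Ω E : Type*} [MeasurableSpace Ω] {μ : Measure Ω}
    [IsProbabilityMeasure μ] {X : E → Ω → ℝ} (hX : ∀ e, Measurable (X e))
    (hindep : iIndepFun X μ) (hident : ∀ e e', IdentDistrib (X e) (X e') μ μ)
    (hpos : ∀ e, ∀ᵐ x ∂μ, 0 < X e x) [Nonempty E] {θ : ℝ} (hθ : 0 < θ) :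
    ∃ δ : ℝ, 0 < δ ∧ ∀ S : Finset E,
      μ {x | ∑ e ∈ S, X e x ≤ δ * S.card} ≤ ENNReal.ofReal (θ ^ S.card) := by
  obtain ⟨e₀⟩ := ‹Nonempty E›
  have hlim := tendsto_mgf_neg_natCast (hX e₀) (hpos e₀)
  have hc : 0 < θ * Real.exp (-1) := by positivity
  -- With δ = 1/n the Chernoff prefactor is exp(|S|), which the factor exp(-1) in the bound on the
  -- Laplace transform cancels.
  obtain ⟨n, hn, hn1⟩ := ((hlim.eventually_lt_const hc).and (Filter.eventually_ge_atTop 1)).exists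
  have hn0 : (0 : ℝ) < n := by exact_mod_cast hn1
  refine ⟨(n : ℝ)⁻¹, by positivity, fun S => ?_⟩
  have hmgf : ∀ e, mgf (X e) μ (-(n : ℝ)) ≤ θ * Real.exp (-1) := fun e => by
    have : mgf (X e) μ = mgf (X e₀) μ := by
      rw [← mgf_id_map (hX e).aemeasurable, ← mgf_id_map (hX e₀).aemeasurable,
        (hident e e₀).map_eq]
    rw [this]; exact hn.le
  have hae : ∀ᵐ x ∂μ, ∀ e ∈ S, 0 < X e x := (Finset.eventually_all S).2 fun e _ => hpos e
  have hint : Integrable (fun x => Real.exp (-(n : ℝ) * (∑ e ∈ S, X e) x)) μ := by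
    refine Integrable.of_bound (C := 1) ?_ ?_
    · have : Measurable (∑ e ∈ S, X e) := by
        simpa only [Finset.sum_fn] using Finset.measurable_sum S fun e _ => hX e
      exact (by fun_prop : Measurable fun x =>
        Real.exp (-(n : ℝ) * (∑ e ∈ S, X e) x)).aestronglyMeasurable
    · filter_upwards [hae] with x hx
      rw [Real.norm_eq_abs, Real.abs_exp, Real.exp_le_one_iff, Finset.sum_apply]
      have : (0 : ℝ) ≤ n * ∑ e ∈ S, X e x :=
        mul_nonneg hn0.le (Finset.sum_nonneg fun e he => (hx e he).le)
      linarith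
  have h := measure_le_le_exp_mul_mgf ((n : ℝ)⁻¹ * S.card) (by linarith : -(n : ℝ) ≤ 0) hint
  rw [hindep.mgf_sum hX] at h
  have hexp : Real.exp (- -(n : ℝ) * ((n : ℝ)⁻¹ * S.card)) = Real.exp 1 ^ S.card := by
    rw [← Real.exp_nat_mul]; congr 1; field_simp
  have hprod : ∏ e ∈ S, mgf (X e) μ (-(n : ℝ)) ≤ (θ * Real.exp (-1)) ^ S.card := by
    rw [← Finset.prod_const]
    exact Finset.prod_le_prod (fun e _ => mgf_nonneg) fun e _ => hmgf e
  have hfin : μ.real {x | (∑ e ∈ S, X e) x ≤ (n : ℝ)⁻¹ * S.card} ≤ θ ^ S.card := by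
    refine h.trans ?_
    rw [hexp]
    refine (mul_le_mul_of_nonneg_left hprod (by positivity)).trans_eq ?_
    rw [← mul_pow]
    congr 1
    rw [mul_left_comm, ← Real.exp_add]; simp
  have := ENNReal.ofReal_le_ofReal hfin
  rw [ofReal_measureReal] at this
  simpa only [Finset.sum_apply] using this

/-- The edge of the square lattice encoded by `(p, b)`. -/
def latticeEdge (w : (Fin 2 → ℤ) × Fin 2) : (latticeGraph 2).edgeSet :=
  ⟨s(w.1, w.1 + unitVec w.2), latticeGraph_adj_add w.1 w.2⟩

lemma latticeEdge_injective : Function.Injective latticeEdge := by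
  rintro ⟨p, b⟩ ⟨q, c⟩ h
  have h' : s(p, p + unitVec b) = s(q, q + unitVec c) := congrArg Subtype.val h
  rw [Sym2.eq_iff] at h'
  rcases h' with ⟨rfl, h2⟩ | ⟨rfl, h2⟩
  · have h3 : unitVec b = unitVec c := add_left_cancel h2
    have : b = c := by
      have := congrFun h3 b
      by_contra hbc
      simp [hbc] at this
    rw [this]
  · exfalso
    rw [add_assoc, add_eq_left] at h2
    have h3 := congrFun h2 c
    simp only [Pi.add_apply, Pi.single_apply, Pi.zero_apply] at h3
    split_ifs at h3 <;> omega

/-- Almost surely, every large plaquette-connected set of edges meeting the first axis not too far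
from the origin has total conductance at least proportional to its size. -/
lemma ae_contour_sum_lower (Q : Measure (Environment 2)) [IsProbabilityMeasure Q]
    (hindep : iIndepFun (fun e (ω : Environment 2) => ω e) Q)
    (hident : ∀ e e', IdentDistrib (fun ω : Environment 2 => ω e) (fun ω => ω e') Q Q)
    (hpos : ∀ e, ∀ᵐ ω ∂Q, 0 < ω e) :
    ∃ δ : ℝ, 0 < δ ∧ ∀ᵐ ω ∂Q, ∃ L : ℕ, ∀ S : Finset ((Fin 2 → ℤ) × Fin 2),
      CutConnected SharePlaquette (S : Set ((Fin 2 → ℤ) × Fin 2)) →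
      (∃ j : ℕ, j < S.card ∧ (![(j : ℤ), 0], 0) ∈ S) → L ≤ S.card →
      δ * S.card ≤ ∑ w ∈ S, (ω (latticeEdge w) : ℝ) := by
  classical
  have hcoe : Measurable ((↑) : ℝ≥0 → ℝ) := measurable_coe_nnreal_real
  -- There are at most l · 8^(2(l-1)) ≤ 128^l codes for contours of size l (eight directions per
  -- step), so the rate 1/256 leaves the summable bound 2^(-l).
  obtain ⟨δ, hδ, hS⟩ := exists_measure_sum_le_pow (μ := Q) (θ := 1 / 256)
    (X := fun (w : (Fin 2 → ℤ) × Fin 2) (ω : Environment 2) => (ω (latticeEdge w) : ℝ))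
    (fun w => hcoe.comp (measurable_pi_apply _))
    ((hindep.precomp latticeEdge_injective).comp (fun _ => ((↑) : ℝ≥0 → ℝ)) fun _ => hcoe)
    (fun w w' => (hident _ _).comp hcoe)
    (fun w => (hpos _).mono fun ω h => by exact_mod_cast h) (by norm_num)
  refine ⟨δ, hδ, ?_⟩
  let T : (l : ℕ) → Fin l → (Fin (2 * (l - 1)) → Fin 2 × Fin 4) → Finset ((Fin 2 → ℤ) × Fin 2) :=
    fun l j c => visited edgeNeighbor (![((j : ℕ) : ℤ), 0], 0) (List.ofFn c)
  let Bad : ℕ → Set (Environment 2) := fun l => ⋃ j : Fin l, ⋃ c,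
    {ω | (T l j c).card = l ∧ ∑ w ∈ T l j c, (ω (latticeEdge w) : ℝ) ≤ δ * (T l j c).card}
  have hBad : ∀ l, Q (Bad l) ≤ ENNReal.ofReal ((1 / 2) ^ l) := by
    intro l
    have h1 : ∀ j c, Q {ω | (T l j c).card = l ∧
        ∑ w ∈ T l j c, (ω (latticeEdge w) : ℝ) ≤ δ * (T l j c).card}
        ≤ ENNReal.ofReal ((1 / 256) ^ l) := by
      intro j c
      by_cases hl : (T l j c).card = l
      · refine (measure_mono fun ω hω => hω.2).trans ((hS (T l j c)).trans_eq ?_)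
        rw [hl]
      · simp [hl]
    calc Q (Bad l) ≤ ∑ j : Fin l, ∑ c, Q {ω | (T l j c).card = l ∧
            ∑ w ∈ T l j c, (ω (latticeEdge w) : ℝ) ≤ δ * (T l j c).card} :=
          (measure_iUnion_fintype_le _ _).trans
            (Finset.sum_le_sum fun j _ => measure_iUnion_fintype_le _ _)
      _ ≤ ∑ j : Fin l, ∑ c : Fin (2 * (l - 1)) → Fin 2 × Fin 4,
            ENNReal.ofReal ((1 / 256) ^ l) :=
          Finset.sum_le_sum fun j _ => Finset.sum_le_sum fun c _ => h1 j c
      _ = ENNReal.ofReal (l * 8 ^ (2 * (l - 1)) * (1 / 256) ^ l) := by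
          rw [ENNReal.ofReal_mul (by positivity)]
          simp only [Finset.sum_const, Finset.card_univ, nsmul_eq_mul, Fintype.card_fun,
            Fintype.card_prod, Fintype.card_fin, ← mul_assoc]
          congr 1
          rw [ENNReal.ofReal_mul (by positivity), ENNReal.ofReal_natCast,
            ENNReal.ofReal_pow (by positivity)]
          simp
      _ ≤ ENNReal.ofReal ((1 / 2) ^ l) := by
          refine ENNReal.ofReal_le_ofReal ?_
          have h2 : (l : ℝ) ≤ 2 ^ l := by exact_mod_cast Nat.lt_two_pow_self.le
          have h3 : (8 : ℝ) ^ (2 * (l - 1)) ≤ 64 ^ l := by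
            rw [pow_mul]
            norm_num
            exact pow_le_pow_right₀ (by norm_num) (Nat.sub_le _ _)
          calc (l : ℝ) * 8 ^ (2 * (l - 1)) * (1 / 256) ^ l ≤ 2 ^ l * 64 ^ l * (1 / 256) ^ l := by
                gcongr
            _ = (1 / 2) ^ l := by rw [← mul_pow, ← mul_pow]; norm_num
  have hsum : ∑' l, Q (Bad l) ≠ ∞ := by
    refine ne_top_of_le_ne_top ?_ (ENNReal.tsum_le_tsum hBad)
    rw [← ENNReal.ofReal_tsum_of_nonneg (fun _ => by positivity)
      (summable_geometric_of_lt_one (by norm_num) (by norm_num))]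
    exact ENNReal.ofReal_ne_top
  filter_upwards [ae_eventually_notMem hsum] with ω hω
  obtain ⟨L, hL⟩ := Filter.eventually_atTop.1 hω
  refine ⟨L, fun S hconn ⟨j, hj, hjS⟩ hLS => ?_⟩
  by_contra! hlt
  obtain ⟨c, hc, hv⟩ := exists_visited_eq edgeNeighbor
    (fun x y h => SharePlaquette.exists_edgeNeighbor h) hconn hjS
  refine hL _ hLS ?_
  have hT : T S.card ⟨j, hj⟩ (fun i => c.get (i.cast hc.symm)) = S := by
    have : List.ofFn (fun i : Fin (2 * (S.card - 1)) => c.get (i.cast hc.symm)) = c := by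
      refine List.ext_get (by simp [hc]) fun n h1 h2 => ?_
      simp
    simp only [T, this, hv]
  refine Set.mem_iUnion.2 ⟨⟨j, hj⟩, Set.mem_iUnion.2
    ⟨fun i => c.get (i.cast hc.symm), ?_⟩⟩
  rw [Set.mem_ofPred_eq, hT]
  exact ⟨rfl, hlt.le⟩

lemma conductance_add {ω : Environment 2} (p : Fin 2 → ℤ) (b : Fin 2) :
    conductance ω p (p + unitVec b) = ω (latticeEdge (p, b)) := by
  rw [conductance, dif_pos (latticeGraph_adj_add p b)]; rfl

lemma conductance_comm {d : ℕ} (ω : Environment d) (x y : Fin d → ℤ) :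
    conductance ω x y = conductance ω y x := by
  unfold conductance
  by_cases h : (latticeGraph d).Adj x y
  · rw [dif_pos h, dif_pos h.symm]
    congr 2
    exact Sym2.eq_swap
  · rw [dif_neg h, dif_neg fun h' => h h'.symm]

/-- The large-scale isoperimetric inequality: almost surely, large finite connected sets containing
the origin have boundary conductance at least of the order of the square root of their size. -/
lemma ae_isoperimetric (Q : Measure (Environment 2)) [IsProbabilityMeasure Q]
    (hindep : iIndepFun (fun e (ω : Environment 2) => ω e) Q)
    (hident : ∀ e e', IdentDistrib (fun ω : Environment 2 => ω e) (fun ω => ω e') Q Q)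
    (hpos : ∀ e, ∀ᵐ ω ∂Q, 0 < ω e) :
    ∃ K : ℝ, 0 < K ∧ ∀ᵐ ω ∂Q, ∃ n : ℕ, ∀ A Λ : Finset (Fin 2 → ℤ), 0 ∈ A →
      CutConnected (latticeGraph 2).Adj (A : Set (Fin 2 → ℤ)) →
      (∀ x ∈ A, ∀ y, (latticeGraph 2).Adj x y → y ∈ Λ) → n ≤ A.card →
      (A.card : ℝ) ≤ K * (∑ x ∈ A, ∑ y ∈ Λ \ A, (conductance ω x y : ℝ)) ^ 2 := by
  classical
  obtain ⟨δ, hδ, hae⟩ := ae_contour_sum_lower Q hindep hident hpos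
  refine ⟨(δ ^ 2)⁻¹, by positivity, ?_⟩
  filter_upwards [hae] with ω ⟨L, hL⟩
  -- Since |A| ≤ |S|², the threshold L² for `A` forces the contour to have at least `L` edges.
  refine ⟨L ^ 2, fun A Λ h0 hA hΛ hn => ?_⟩
  obtain ⟨S, hS1, hS2, hS3, hS4⟩ := exists_contour A h0 hA
  have h1 := hL S hS1 hS2 ((Nat.pow_le_pow_iff_left two_ne_zero).1 (hn.trans hS3))
  have h2 : ∑ w ∈ S, (ω (latticeEdge w) : ℝ)
      ≤ ∑ x ∈ A, ∑ y ∈ Λ \ A, (conductance ω x y : ℝ) := by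
    rw [← Finset.sum_product']
    -- Contour edges are oriented outward from `A`, which embeds them into the pairs summed in the
    -- cut.
    let ψ : (Fin 2 → ℤ) × Fin 2 → (Fin 2 → ℤ) × (Fin 2 → ℤ) := fun w =>
      if w.1 ∈ A then (w.1, w.1 + unitVec w.2) else (w.1 + unitVec w.2, w.1)
    have hval : ∀ w, (ω (latticeEdge w) : ℝ) = conductance ω (ψ w).1 (ψ w).2 := by
      rintro ⟨p, b⟩
      simp only [ψ]
      split_ifs
      · rw [conductance_add]
      · rw [conductance_comm, conductance_add]
    have hedge : ∀ w, s((ψ w).1, (ψ w).2) = (latticeEdge w : Sym2 (Fin 2 → ℤ)) := by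
      rintro ⟨p, b⟩
      simp only [ψ]
      split_ifs
      · rfl
      · exact Sym2.eq_swap
    have hinj : Function.Injective ψ := fun w w' h =>
      latticeEdge_injective (Subtype.ext (by rw [← hedge, ← hedge, h]))
    have hmaps : S.image ψ ⊆ A ×ˢ (Λ \ A) := by
      intro z hz
      obtain ⟨⟨p, b⟩, hw, rfl⟩ := Finset.mem_image.1 hz
      have hadj := latticeGraph_adj_add p b
      rcases hS4 _ hw with ⟨ha, hb⟩ | ⟨ha, hb⟩
      · simp only at ha hb
        simp [ψ, ha, hb, hΛ p ha _ hadj]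
      · simp only at ha hb
        simp [ψ, ha, hb, hΛ _ hb _ hadj.symm]
    calc ∑ w ∈ S, (ω (latticeEdge w) : ℝ) = ∑ z ∈ S.image ψ, (conductance ω z.1 z.2 : ℝ) := by
          rw [Finset.sum_image hinj.injOn]
          exact Finset.sum_congr rfl fun w _ => hval w
      _ ≤ _ := Finset.sum_le_sum_of_subset_of_nonneg hmaps fun _ _ _ => NNReal.coe_nonneg _
  rw [inv_mul_eq_div, le_div_iff₀ (by positivity)]
  calc (A.card : ℝ) * δ ^ 2 ≤ (S.card : ℝ) ^ 2 * δ ^ 2 := by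
        gcongr; exact_mod_cast hS3
    _ = (δ * S.card) ^ 2 := by ring
    _ ≤ _ := by gcongr; exact h1.trans h2

/-! ### Level sets of Green subsolutions -/

/-- `g` is a nonnegative function supported in the finite set `B` whose weighted Laplacian, for the
conductances `c` on the graph `r`, is at least `-δ_o` on `B`. The finite set `Λ` contains `B` and
its neighbours. -/
structure IsGreenSubsolution {V : Type*} [DecidableEq V] (r : V → V → Prop) (c : V → V → ℝ)
    (Λ B : Finset V) (o : V) (g : V → ℝ) : Prop where
  rel_symm : ∀ x y, r x y → r y x
  cond_symm : ∀ x y, c x y = c y x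
  cond_nonneg : ∀ x y, 0 ≤ c x y
  cond_pos : ∀ x y, r x y → 0 < c x y
  cond_zero : ∀ x y, ¬r x y → c x y = 0
  subset : B ⊆ Λ
  neighbor_mem : ∀ x ∈ B, ∀ y, r x y → y ∈ Λ
  nonneg : ∀ x, 0 ≤ g x
  eq_zero : ∀ x ∉ B, g x = 0
  laplacian_le : ∀ y ∈ B,
    (∑ x ∈ Λ, c y x) * g y ≤ (if y = o then 1 else 0) + ∑ x ∈ Λ, c y x * g x

namespace IsGreenSubsolution

variable {V : Type*} [DecidableEq V] {r : V → V → Prop} {c : V → V → ℝ} {Λ B : Finset V} {o : V}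
  {g : V → ℝ}

/-- The energy of a monotone `1`-Lipschitz truncation of `g` is at most twice its value at the
pole. -/
lemma energy_le (h : IsGreenSubsolution r c Λ B o g) {u : V → ℝ} (hu : ∀ x, 0 ≤ u x)
    (hu0 : ∀ x ∉ B, u x = 0) (hug : ∀ x y, (u x - u y) ^ 2 ≤ (u x - u y) * (g x - g y)) :
    ∑ x ∈ Λ, ∑ y ∈ Λ, c x y * (u x - u y) ^ 2 ≤ 2 * u o := by
  have hpt : ∀ x ∈ Λ, u x * ((∑ y ∈ Λ, c x y) * g x - ∑ y ∈ Λ, c x y * g y)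
      ≤ if x = o then u x else 0 := by
    intro x _
    by_cases hx : x ∈ B
    · have h1 := h.laplacian_le x hx
      calc u x * ((∑ y ∈ Λ, c x y) * g x - ∑ y ∈ Λ, c x y * g y)
          ≤ u x * (if x = o then 1 else 0) := mul_le_mul_of_nonneg_left (by linarith) (hu x)
        _ = _ := by split_ifs <;> simp
    · rw [hu0 x hx]; simp
  have hsum : ∑ x ∈ Λ, u x * ((∑ y ∈ Λ, c x y) * g x - ∑ y ∈ Λ, c x y * g y) ≤ u o := by
    refine (Finset.sum_le_sum hpt).trans ?_
    rw [Finset.sum_ite_eq']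
    split_ifs
    · exact le_rfl
    · exact hu o
  have hexp : ∑ x ∈ Λ, u x * ((∑ y ∈ Λ, c x y) * g x - ∑ y ∈ Λ, c x y * g y)
      = ∑ x ∈ Λ, ∑ y ∈ Λ, c x y * u x * (g x - g y) := by
    refine Finset.sum_congr rfl fun x _ => ?_
    rw [Finset.sum_mul, ← Finset.sum_sub_distrib, Finset.mul_sum]
    exact Finset.sum_congr rfl fun y _ => by ring
  -- Summation by parts: symmetrizing turns the pairing of `u` with the Laplacian of `g` into half
  -- the mixed energy, which dominates half the energy of `u` by `hug`.
  have hswap : ∑ x ∈ Λ, ∑ y ∈ Λ, c x y * u x * (g x - g y)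
      = ∑ x ∈ Λ, ∑ y ∈ Λ, c x y * u y * (g y - g x) := by
    rw [Finset.sum_comm]
    exact Finset.sum_congr rfl fun y _ => Finset.sum_congr rfl fun x _ => by rw [h.cond_symm]
  calc ∑ x ∈ Λ, ∑ y ∈ Λ, c x y * (u x - u y) ^ 2
      ≤ ∑ x ∈ Λ, ∑ y ∈ Λ, (c x y * u x * (g x - g y) + c x y * u y * (g y - g x)) :=
        Finset.sum_le_sum fun x _ => Finset.sum_le_sum fun y _ => by
          have := mul_le_mul_of_nonneg_left (hug x y) (h.cond_nonneg x y)
          linarith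
    _ = 2 * ∑ x ∈ Λ, ∑ y ∈ Λ, c x y * u x * (g x - g y) := by
        simp only [Finset.sum_add_distrib]
        rw [← hswap]; ring
    _ ≤ 2 * u o := by rw [← hexp]; linarith

/-- The maximum principle. -/
lemma not_isolated (h : IsGreenSubsolution r c Λ B o g)
    (hinf : ∀ T : Finset V, T.Nonempty → ∃ x ∈ T, ∃ y, y ∉ T ∧ r x y)
    {T : Finset V} (hTB : T ⊆ B) (hT : T.Nonempty) (ho : o ∉ T) {t : ℝ} (hgt : ∀ x ∈ T, t < g x)
    (hle : ∀ x ∈ T, ∀ y ∉ T, r x y → g y ≤ t) : False := by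
  obtain ⟨z, hz, hmax⟩ := T.exists_max_image g hT
  -- Some maximum point has a neighbour outside the set of maximum points; there `g` is strictly
  -- smaller, against the subsolution inequality away from the pole.
  obtain ⟨x, hx, y, hy, hxy⟩ := hinf (T.filter fun x => g x = g z)
    ⟨z, Finset.mem_filter.2 ⟨hz, rfl⟩⟩
  obtain ⟨hxT, hxz⟩ := Finset.mem_filter.1 hx
  have hnb : ∀ y, r x y → g y ≤ g x := fun y hxy => by
    by_cases hyT : y ∈ T
    · rw [hxz]; exact hmax y hyT
    · exact (hle x hxT y hyT hxy).trans (hgt x hxT).le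
  have hlt : g y < g x := by
    by_cases hyT : y ∈ T
    · refine lt_of_le_of_ne (hnb y hxy) fun heq => hy (Finset.mem_filter.2 ⟨hyT, heq.trans hxz⟩)
    · exact (hle x hxT y hyT hxy).trans_lt (hgt x hxT)
  have h1 := h.laplacian_le x (hTB hxT)
  rw [if_neg (ne_of_mem_of_not_mem hxT ho), zero_add, Finset.sum_mul] at h1
  refine absurd h1 (not_le.2 (Finset.sum_lt_sum (fun w _ => ?_)
    ⟨y, h.neighbor_mem x (hTB hxT) y hxy, mul_lt_mul_of_pos_left hlt (h.cond_pos x y hxy)⟩))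
  by_cases hw : r x w
  · exact mul_le_mul_of_nonneg_left (hnb w hw) (h.cond_nonneg x w)
  · simp [h.cond_zero x w hw]

lemma level_mem (h : IsGreenSubsolution r c Λ B o g)
    (hinf : ∀ T : Finset V, T.Nonempty → ∃ x ∈ T, ∃ y, y ∉ T ∧ r x y)
    {t : ℝ} (ht : 0 ≤ t)
    (hne : (B.filter (t < g ·)).Nonempty) : o ∈ B.filter (t < g ·) := by
  by_contra ho
  refine h.not_isolated hinf (Finset.filter_subset _ _) hne ho (t := t)
    (fun x hx => (Finset.mem_filter.1 hx).2) (fun x _ y hy _ => ?_)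
  by_cases hyB : y ∈ B
  · by_contra hlt; exact hy (Finset.mem_filter.2 ⟨hyB, not_le.1 hlt⟩)
  · rw [h.eq_zero y hyB]; exact ht

/-- If the level set split into two unrelated pieces, the piece without the pole would have only
outside neighbours of height at most `t`, against `not_isolated`. -/
lemma level_connected (h : IsGreenSubsolution r c Λ B o g)
    (hinf : ∀ T : Finset V, T.Nonempty → ∃ x ∈ T, ∃ y, y ∉ T ∧ r x y)
    {t : ℝ} (ht : 0 ≤ t) :
    CutConnected r (B.filter (t < g ·) : Set V) := by
  classical
  set L := B.filter (t < g ·) with hL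
  have hout : ∀ y ∉ L, g y ≤ t := fun y hy => by
    by_cases hyB : y ∈ B
    · by_contra hlt; exact hy (Finset.mem_filter.2 ⟨hyB, not_le.1 hlt⟩)
    · rw [h.eq_zero y hyB]; exact ht
  intro T hT hne hTL
  by_contra! hcon
  obtain ⟨x, hx⟩ := hne
  obtain ⟨z, hz, hzT⟩ := Set.exists_of_ssubset (hT.ssubset_of_ne hTL)
  by_cases ho : o ∈ T
  · refine h.not_isolated hinf (T := L.filter (· ∉ T)) ((Finset.filter_subset _ _).trans
      (Finset.filter_subset _ _)) ⟨z, Finset.mem_filter.2 ⟨hz, hzT⟩⟩ (by simp [ho]) (t := t)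
      (fun x hx => (Finset.mem_filter.1 (Finset.mem_filter.1 hx).1).2) (fun x hx y hy hxy => ?_)
    obtain ⟨hx1, hx2⟩ := Finset.mem_filter.1 hx
    refine hout y fun hyL => ?_
    by_cases hyT : y ∈ T
    · exact hcon y hyT x hx1 hx2 (h.rel_symm _ _ hxy)
    · exact hy (Finset.mem_filter.2 ⟨hyL, hyT⟩)
  · refine h.not_isolated hinf (T := L.filter (· ∈ T)) ((Finset.filter_subset _ _).trans
      (Finset.filter_subset _ _)) ⟨x, Finset.mem_filter.2 ⟨hT hx, hx⟩⟩ (by simp [ho]) (t := t)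
      (fun x hx => (Finset.mem_filter.1 (Finset.mem_filter.1 hx).1).2) (fun x hx y hy hxy => ?_)
    obtain ⟨hx1, hx2⟩ := Finset.mem_filter.1 hx
    refine hout y fun hyL => ?_
    by_cases hyT : y ∈ T
    · exact hy (Finset.mem_filter.2 ⟨hyL, hyT⟩)
    · exact hcon x hx2 y hyL hyT hxy

/-- Clipping is monotone and 1-Lipschitz; this is the form required by `energy_le`. -/
lemma clip_mul_le (a b t s : ℝ) :
    (min (max (a - t) 0) s - min (max (b - t) 0) s) ^ 2 ≤
      (min (max (a - t) 0) s - min (max (b - t) 0) s) * (a - b) := by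
  rcases le_total a b with hab | hab
  · have h1 : min (max (a - t) 0) s ≤ min (max (b - t) 0) s := by gcongr
    have h2 : min (max (b - t) 0) s - min (max (a - t) 0) s ≤ b - a := by
      simp only [min_def, max_def]; split_ifs <;> linarith
    nlinarith
  · have h1 : min (max (b - t) 0) s ≤ min (max (a - t) 0) s := by gcongr
    have h2 : min (max (a - t) 0) s - min (max (b - t) 0) s ≤ a - b := by
      simp only [min_def, max_def]; split_ifs <;> linarith
    nlinarith

/-- A lower bound for all the cuts of levels in `[t, t + s)` bounds the total variation of the
truncation of `g` between `t` and `t + s` from below. -/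
lemma coarea (hBΛ : B ⊆ Λ) (hzero : ∀ x ∉ B, g x = 0) {t s b : ℝ} (ht : 0 ≤ t) (hs : 0 ≤ s)
    (hb : ∀ q, t ≤ q → q < t + s →
      b ≤ ∑ x ∈ B.filter (q < g ·), ∑ y ∈ Λ \ B.filter (q < g ·), c x y) :
    s * b ≤ ∑ x ∈ Λ, ∑ y ∈ Λ,
      c x y * max (min (max (g x - t) 0) s - min (max (g y - t) 0) s) 0 := by
  have hint : ∀ x y, IntegrableOn (fun q => c x y * (Set.Ico (g y) (g x)).indicator 1 q)
      (Set.Ico t (t + s)) := fun x y =>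
    Integrable.const_mul ((integrable_const (1 : ℝ)).indicator measurableSet_Ico) _
  -- The levels separating `y` from `x` within the window form an interval whose length is the
  -- positive part of the clipped increment.
  have hval : ∀ x y, ∫ q in Set.Ico t (t + s), c x y * (Set.Ico (g y) (g x)).indicator 1 q
      = c x y * max (min (max (g x - t) 0) s - min (max (g y - t) 0) s) 0 := by
    intro x y
    rw [integral_const_mul, setIntegral_indicator measurableSet_Ico, Set.Ico_inter_Ico]
    simp only [Pi.one_apply, setIntegral_const, smul_eq_mul, mul_one, Real.volume_real_Ico]
    congr 1
    simp only [min_def, max_def]; split_ifs <;> linarith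
  have hcut : ∀ q ∈ Set.Ico t (t + s), b ≤ ∑ x ∈ Λ, ∑ y ∈ Λ,
      c x y * (Set.Ico (g y) (g x)).indicator 1 q := by
    intro q hq
    refine (hb q hq.1 hq.2).trans_eq ?_
    have hlev : ∀ x, x ∈ B.filter (q < g ·) ↔ q < g x := fun x => by
      rw [Finset.mem_filter, and_iff_right_iff_imp]
      intro hx
      by_contra hxB
      rw [hzero x hxB] at hx
      linarith [hq.1]
    rw [← Finset.sum_subset ((Finset.filter_subset (q < g ·) B).trans hBΛ)]
    · refine Finset.sum_congr rfl fun x hx => ?_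
      rw [← Finset.sum_subset (Finset.sdiff_subset : Λ \ B.filter (q < g ·) ⊆ Λ)]
      · refine Finset.sum_congr rfl fun y hy => ?_
        have hy' : g y ≤ q := by
          have := (Finset.mem_sdiff.1 hy).2
          rw [hlev] at this; linarith
        simp [Set.indicator_of_mem (show q ∈ Set.Ico (g y) (g x) from ⟨hy', (hlev x).1 hx⟩)]
      · intro y hyΛ hy
        have hy' : q < g y := by
          rw [← hlev]
          by_contra h'; exact hy (Finset.mem_sdiff.2 ⟨hyΛ, h'⟩)
        rw [Set.indicator_of_notMem (fun h' => absurd h'.1 (not_le.2 hy')), mul_zero]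
    · intro x _ hx
      rw [hlev] at hx
      refine Finset.sum_eq_zero fun y _ => ?_
      rw [Set.indicator_of_notMem (fun h' => hx h'.2), mul_zero]
  calc s * b = ∫ _ in Set.Ico t (t + s), b := by
        simp [hs]
    _ ≤ ∫ q in Set.Ico t (t + s), ∑ x ∈ Λ, ∑ y ∈ Λ,
          c x y * (Set.Ico (g y) (g x)).indicator 1 q :=
        setIntegral_mono_on (integrable_const _)
          (integrable_finsetSum _ fun x _ => integrable_finsetSum _ fun y _ => hint x y)
          measurableSet_Ico hcut
    _ = _ := by
        rw [integral_finsetSum _ fun x _ => integrable_finsetSum _ fun y _ => hint x y]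
        refine Finset.sum_congr rfl fun x _ => ?_
        rw [integral_finsetSum _ fun y _ => hint x y]
        exact Finset.sum_congr rfl fun y _ => hval x y

/-- The cuts of the levels in `[t, t + s)` are controlled by the volume of the level `t`. -/
lemma cut_sq_le (h : IsGreenSubsolution r c Λ B o g) {t s b : ℝ} (ht : 0 ≤ t) (hs : 0 < s)
    (hb0 : 0 ≤ b)
    (hb : ∀ q, t ≤ q → q < t + s →
      b ≤ ∑ x ∈ B.filter (q < g ·), ∑ y ∈ Λ \ B.filter (q < g ·), c x y) :
    s * b ^ 2 ≤ 2 * ∑ x ∈ B.filter (t < g ·), ∑ y ∈ Λ, c x y := by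
  set u : V → ℝ := fun x => min (max (g x - t) 0) s with hu
  have hu0 : ∀ x, 0 ≤ u x := fun x => le_min (le_max_right _ _) hs.le
  have huz : ∀ x, g x ≤ t → u x = 0 := fun x hx => by
    simp [hu, max_eq_right (sub_nonpos.2 hx), hs.le]
  have hE := h.energy_le hu0 (fun x hx => huz x (by rw [h.eq_zero x hx]; exact ht))
    (fun x y => clip_mul_le (g x) (g y) t s)
  have hco := coarea h.subset h.eq_zero ht hs.le hb
  -- Only pairs with `t < g x` contribute, so one Cauchy–Schwarz factor is at most the volume of the
  -- level `t`; the other is at most the energy, hence at most 2s.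
  have hCS := Finset.sum_sq_le_sum_mul_sum_of_sq_le_mul (Λ ×ˢ Λ)
    (r := fun z => c z.1 z.2 * max (u z.1 - u z.2) 0)
    (f := fun z => if t < g z.1 then c z.1 z.2 else 0)
    (g := fun z => c z.1 z.2 * (max (u z.1 - u z.2) 0) ^ 2)
    (fun z _ => by split_ifs; exacts [h.cond_nonneg _ _, le_rfl])
    (fun z _ => mul_nonneg (h.cond_nonneg _ _) (sq_nonneg _))
    (fun z _ => by
      split_ifs with hz
      · exact le_of_eq (by ring)
      · rw [huz z.1 (not_lt.1 hz), max_eq_right (by linarith [hu0 z.2])]; simp)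
  simp only [Finset.sum_product] at hCS
  have h1 : ∑ x ∈ Λ, ∑ y ∈ Λ, (if t < g x then c x y else 0)
      ≤ ∑ x ∈ B.filter (t < g ·), ∑ y ∈ Λ, c x y := by
    rw [← Finset.sum_subset ((Finset.filter_subset (t < g ·) B).trans h.subset)]
    · refine Finset.sum_le_sum fun x _ => Finset.sum_le_sum fun y _ => ?_
      split_ifs; exacts [le_rfl, h.cond_nonneg _ _]
    · intro x _ hx
      refine Finset.sum_eq_zero fun y _ => if_neg fun hlt => hx (Finset.mem_filter.2 ⟨?_, hlt⟩)
      by_contra hxB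
      rw [h.eq_zero x hxB] at hlt; linarith
  have h2 : ∑ x ∈ Λ, ∑ y ∈ Λ, c x y * (max (u x - u y) 0) ^ 2 ≤ 2 * s := by
    refine le_trans ?_ (hE.trans (by gcongr; exact min_le_right _ _))
    refine Finset.sum_le_sum fun x _ => Finset.sum_le_sum fun y _ => ?_
    refine mul_le_mul_of_nonneg_left ?_ (h.cond_nonneg x y)
    rcases le_total (u x - u y) 0 with h' | h'
    · rw [max_eq_right h', zero_pow two_ne_zero]; exact sq_nonneg _
    · rw [max_eq_left h']
  have h3 : (s * b) ^ 2 ≤ (∑ x ∈ B.filter (t < g ·), ∑ y ∈ Λ, c x y) * (2 * s) := by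
    refine (pow_le_pow_left₀ (mul_nonneg hs.le hb0) hco 2).trans (hCS.trans ?_)
    refine mul_le_mul h1 h2 ?_ ?_
    · exact Finset.sum_nonneg fun x _ => Finset.sum_nonneg fun y _ =>
        mul_nonneg (h.cond_nonneg _ _) (sq_nonneg _)
    · exact Finset.sum_nonneg fun x _ => Finset.sum_nonneg fun y _ => h.cond_nonneg _ _
  have h4 : s * (s * b ^ 2) ≤ s * (2 * ∑ x ∈ B.filter (t < g ·), ∑ y ∈ Λ, c x y) := by
    linarith
  exact le_of_mul_le_mul_left h4 hs

/-- The oscillation of `g` above a level reached within `n` steps of a path with conductances at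
least `κ`. -/
lemma sub_le_of_path (h : IsGreenSubsolution r c Λ B o g) {t κ : ℝ} (ht : 0 ≤ t) (hκ : 0 < κ)
    {p : ℕ → V} {n : ℕ} (hp0 : p 0 = o) (hadj : ∀ i, r (p i) (p (i + 1)))
    (hcond : ∀ i < n, κ ≤ c (p i) (p (i + 1))) {j : ℕ} (hj : j ≤ n)
    (hout : g (p j) ≤ t) : g o - t ≤ 2 * n ^ 2 / κ := by
  set u : V → ℝ := fun x => max (g x - t) 0 with hu
  have hu0 : ∀ x, 0 ≤ u x := fun x => le_max_right _ _
  have huz : ∀ x, g x ≤ t → u x = 0 := fun x hx => max_eq_right (sub_nonpos.2 hx)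
  -- Clipping from above at `max (u x) (u y)` changes neither value, so `clip_mul_le` covers the
  -- one-sided truncation.
  have hE := h.energy_le hu0 (fun x hx => huz x (by rw [h.eq_zero x hx]; exact ht)) (fun x y => by
    have := clip_mul_le (g x) (g y) t (max (u x) (u y))
    rwa [min_eq_left (le_max_left _ _), min_eq_left (le_max_right _ _)] at this)
  set d := Real.sqrt (2 * u o / κ) with hd
  have hd2 : d ^ 2 = 2 * u o / κ := Real.sq_sqrt (div_nonneg (by linarith [hu0 o]) hκ.le)
  -- A single edge carries at most the total energy 2u(o), so `u` drops by at most `d` per step.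
  -- Reaching 0 within `n` steps gives u(o)² ≤ 2n²u(o)/κ.
  have hstep : ∀ i < n, u (p i) ≤ u (p (i + 1)) + d := by
    intro i hi
    by_cases hgt : t < g (p i)
    · have hB : p i ∈ B := by
        by_contra hB
        rw [h.eq_zero _ hB] at hgt; linarith
      have h1 : c (p i) (p (i + 1)) * (u (p i) - u (p (i + 1))) ^ 2 ≤ 2 * u o := by
        refine le_trans ?_ hE
        refine le_trans ?_ (Finset.single_le_sum (f := fun x => ∑ y ∈ Λ, c x y * (u x - u y) ^ 2)
          (fun x _ => Finset.sum_nonneg fun y _ => mul_nonneg (h.cond_nonneg _ _) (sq_nonneg _))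
          (h.subset hB))
        exact Finset.single_le_sum (f := fun y => c (p i) y * (u (p i) - u y) ^ 2)
          (fun y _ => mul_nonneg (h.cond_nonneg _ _) (sq_nonneg _))
          (h.neighbor_mem _ hB _ (hadj i))
      have h2 : (u (p i) - u (p (i + 1))) ^ 2 ≤ 2 * u o / κ := by
        rw [le_div_iff₀ hκ, mul_comm]
        exact (mul_le_mul_of_nonneg_right (hcond i hi) (sq_nonneg _)).trans h1
      linarith [Real.le_sqrt_of_sq_le h2]
    · rw [huz _ (not_lt.1 hgt)]
      exact add_nonneg (hu0 _) (Real.sqrt_nonneg _)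
  have hsum : ∀ i ≤ n, u o ≤ u (p i) + i * d := by
    intro i
    induction i with
    | zero => intro _; simp [hp0]
    | succ i ih =>
      intro hi
      have := ih (by omega)
      have := hstep i (by omega)
      push_cast
      linarith
  have h1 := hsum j hj
  rw [huz _ hout, zero_add] at h1
  have h2 : u o ≤ n * d := h1.trans (by
    have : (j : ℝ) ≤ n := by exact_mod_cast hj
    exact mul_le_mul_of_nonneg_right this (Real.sqrt_nonneg _))
  have h3 : u o ^ 2 ≤ n ^ 2 * (2 * u o / κ) := by
    rw [← hd2, ← mul_pow]
    exact pow_le_pow_left₀ (hu0 o) h2 2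
  refine (le_max_left (g o - t) 0).trans ?_
  change u o ≤ _
  rcases (hu0 o).eq_or_lt with h0 | h0
  · rw [← h0]; positivity
  · have : u o * u o ≤ u o * (2 * n ^ 2 / κ) := by
      calc u o * u o = u o ^ 2 := by ring
        _ ≤ _ := h3
        _ = _ := by ring
    exact le_of_mul_le_mul_left this h0

end IsGreenSubsolution

namespace IsGreenSubsolution

variable {V : Type*} [DecidableEq V] {r : V → V → Prop} {c : V → V → ℝ} {Λ B : Finset V} {o : V}
  {g : V → ℝ}

/-- If all levels of size at least `n` satisfy a two-dimensional isoperimetric inequality, then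
the integral of `g` is at most linear in the volume of its support. -/
lemma sum_le (h : IsGreenSubsolution r c Λ B o g)
    (hinf : ∀ T : Finset V, T.Nonempty → ∃ x ∈ T, ∃ y, y ∉ T ∧ r x y)
    {K M κ : ℝ} (hK : 0 < K) (hM : 0 < M) (hκ : 0 < κ) {n : ℕ}
    (hm : ∀ x, ∑ y ∈ Λ, c x y ≤ M)
    (hiso : ∀ A ⊆ B, o ∈ A → CutConnected r (A : Set V) → n ≤ A.card →
      (A.card : ℝ) ≤ K * (∑ x ∈ A, ∑ y ∈ Λ \ A, c x y) ^ 2)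
    {p : ℕ → V} (hp : Function.Injective p) (hp0 : p 0 = o) (hadj : ∀ i, r (p i) (p (i + 1)))
    (hcond : ∀ i < n, κ ≤ c (p i) (p (i + 1))) :
    ∑ x ∈ B, (∑ y ∈ Λ, c x y) * g x ≤
      8 * M * K * ∑ x ∈ B, ∑ y ∈ Λ, c x y + M * n * (2 * n ^ 2 / κ) := by
  set m : V → ℝ := fun x => ∑ y ∈ Λ, c x y with hmdef
  have hm0 : ∀ x, 0 ≤ m x := fun x => Finset.sum_nonneg fun y _ => h.cond_nonneg x y
  set L : ℝ → Finset V := fun t => B.filter (t < g ·) with hL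
  set W : ℝ → ℝ := fun t => ∑ x ∈ L t, m x with hW
  set F : ℝ → ℝ := fun t => ∑ x ∈ B, m x * max (g x - t) 0 with hF
  have hW0 : ∀ t, 0 ≤ W t := fun t => Finset.sum_nonneg fun x _ => hm0 x
  have hFL : ∀ t, F t = ∑ x ∈ L t, m x * max (g x - t) 0 := fun t => by
    refine (Finset.sum_subset (Finset.filter_subset _ _) fun x hx hxL => ?_).symm
    have : g x ≤ t := by
      by_contra hlt; exact hxL (Finset.mem_filter.2 ⟨hx, not_le.1 hlt⟩)
    rw [max_eq_right (sub_nonpos.2 this), mul_zero]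
  have hmax : ∀ x ∈ B, g x ≤ g o := fun x hx => by
    by_contra hlt
    have := h.level_mem hinf (h.nonneg o) ⟨x, Finset.mem_filter.2 ⟨hx, not_le.1 hlt⟩⟩
    exact lt_irrefl _ (Finset.mem_filter.1 this).2
  have hWcard : ∀ t, W t ≤ M * (L t).card := fun t => by
    refine (Finset.sum_le_sum fun x _ => hm x).trans_eq ?_
    rw [Finset.sum_const, nsmul_eq_mul, mul_comm]
  -- With b² = W(t + s)/(MK), this choice turns s b² ≤ 2W(t) into 4W(t + s) ≤ 2W(t).
  set s : ℝ := 4 * M * K with hs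
  have hs0 : 0 < s := by positivity
  set c₀ : ℝ := M * n * (2 * n ^ 2 / κ) with hc₀
  have hc₀0 : 0 ≤ c₀ := by positivity
  -- Fewer than `n` vertices cannot contain the first n + 1 points of the path, so the path leaves
  -- the level set.
  have hsmall : ∀ t, 0 ≤ t → (L t).card < n → F t ≤ c₀ := by
    intro t ht hcard
    obtain ⟨j, hj, hjL⟩ : ∃ j ≤ n, p j ∉ L t := by
      by_contra! hcon
      have hsub : (Finset.range (n + 1)).image p ⊆ L t := fun z hz => by
        obtain ⟨i, hi, rfl⟩ := Finset.mem_image.1 hz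
        exact hcon i (by simpa [Nat.lt_succ_iff] using hi)
      have := Finset.card_le_card hsub
      rw [Finset.card_image_of_injective _ hp, Finset.card_range] at this
      omega
    have hgj : g (p j) ≤ t := by
      by_cases hjB : p j ∈ B
      · by_contra hlt; exact hjL (Finset.mem_filter.2 ⟨hjB, not_le.1 hlt⟩)
      · rw [h.eq_zero _ hjB]; exact ht
    have hosc := h.sub_le_of_path ht hκ hp0 hadj hcond hj hgj
    have hR : (0 : ℝ) ≤ 2 * n ^ 2 / κ := by positivity
    rw [hFL]
    calc ∑ x ∈ L t, m x * max (g x - t) 0 ≤ ∑ x ∈ L t, M * (2 * n ^ 2 / κ) := by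
          refine Finset.sum_le_sum fun x hx => ?_
          have := hmax x (Finset.mem_filter.1 hx).1
          exact mul_le_mul (hm x) (max_le (by linarith) hR) (le_max_right _ _) hM.le
      _ = (L t).card * (M * (2 * n ^ 2 / κ)) := by rw [Finset.sum_const, nsmul_eq_mul]
      _ ≤ n * (M * (2 * n ^ 2 / κ)) := by gcongr
      _ = c₀ := by rw [hc₀]; ring
  have hstep : ∀ t, F t ≤ s * W t + F (t + s) := by
    intro t
    have h1 : F (t + s) ≥ ∑ x ∈ L t, m x * max (g x - (t + s)) 0 :=
      Finset.sum_le_sum_of_subset_of_nonneg (Finset.filter_subset _ _)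
        fun x _ _ => mul_nonneg (hm0 x) (le_max_right _ _)
    rw [hFL]
    refine le_trans ?_ (add_le_add_right h1 _)
    rw [hW, Finset.mul_sum, ← Finset.sum_add_distrib]
    refine Finset.sum_le_sum fun x _ => ?_
    have : max (g x - t) 0 ≤ s + max (g x - (t + s)) 0 :=
      max_le (by linarith [le_max_left (g x - (t + s)) 0])
        (by linarith [le_max_right (g x - (t + s)) 0])
    have := mul_le_mul_of_nonneg_left this (hm0 x)
    linarith
  have hhalf : ∀ t, 0 ≤ t → (L (t + s)).Nonempty → n ≤ (L (t + s)).card →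
      2 * W (t + s) ≤ W t := by
    intro t ht hne hcard
    set b := Real.sqrt (W (t + s) / (M * K)) with hb
    have hcut := h.cut_sq_le (b := b) ht hs0 (Real.sqrt_nonneg _) (fun q hq1 hq2 => by
      have hq0 : 0 ≤ q := ht.trans hq1
      have hsub : L (t + s) ⊆ L q := fun x hx =>
        Finset.mem_filter.2 ⟨(Finset.mem_filter.1 hx).1, hq2.trans (Finset.mem_filter.1 hx).2⟩
      have hcn := Finset.card_le_card hsub
      have h1 := hiso (L q) (Finset.filter_subset _ _) (h.level_mem hinf hq0 (hne.mono hsub))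
        (h.level_connected hinf hq0) (hcard.trans hcn)
      refine Real.sqrt_le_iff.2 ⟨Finset.sum_nonneg fun x _ => Finset.sum_nonneg fun y _ =>
        h.cond_nonneg x y, ?_⟩
      rw [div_le_iff₀ (by positivity)]
      calc W (t + s) ≤ M * (L (t + s)).card := hWcard _
        _ ≤ M * (L q).card := by gcongr
        _ ≤ M * (K * (∑ x ∈ L q, ∑ y ∈ Λ \ L q, c x y) ^ 2) := by gcongr
        _ = _ := by ring)
    rw [hb, Real.sq_sqrt (div_nonneg (hW0 _) (by positivity))] at hcut
    have : s * (W (t + s) / (M * K)) = 4 * W (t + s) := by rw [hs]; field_simp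
    rw [this] at hcut
    change 4 * W (t + s) ≤ 2 * W t at hcut
    linarith
  have hempty : ∀ t, ¬(L t).Nonempty → F t ≤ 0 := fun t hne => by
    rw [hFL, Finset.not_nonempty_iff_eq_empty.1 hne, Finset.sum_empty]
  -- Induction downward from the maximum of `g`: F(t) ≤ sW(t) + F(t + s) ≤ sW(t) + 2sW(t + s) + c₀,
  -- and halving absorbs the middle term. At a small or empty level the recursion stops.
  have key : ∀ k : ℕ, ∀ t, 0 ≤ t → g o ≤ t + k * s → F t ≤ 2 * s * W t + c₀ := by
    intro k
    induction k with
    | zero =>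
      intro t ht hgo
      have : ¬(L t).Nonempty := fun ⟨x, hx⟩ => by
        have h1 := Finset.mem_filter.1 hx
        have := hmax x h1.1
        simp at hgo
        linarith [h1.2]
      have h1 := hempty t this
      have : 0 ≤ 2 * s * W t := mul_nonneg (by positivity) (hW0 t)
      linarith
    | succ k ih =>
      intro t ht hgo
      have hst := hstep t
      have hWt : 0 ≤ s * W t := mul_nonneg hs0.le (hW0 t)
      by_cases hne : (L (t + s)).Nonempty
      · by_cases hcard : n ≤ (L (t + s)).card
        · have h1 := ih (t + s) (by linarith) (by push_cast at hgo; linarith)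
          have h2 := mul_le_mul_of_nonneg_left (hhalf t ht hne hcard) hs0.le
          linarith
        · have := hsmall (t + s) (by linarith) (not_le.1 hcard)
          linarith
      · have := hempty _ hne
        linarith
  obtain ⟨k, hk⟩ := exists_nat_ge (g o / s)
  have h0 := key k 0 le_rfl (by rw [div_le_iff₀ hs0] at hk; linarith)
  have hF0 : F 0 = ∑ x ∈ B, m x * g x := Finset.sum_congr rfl fun x _ => by
    rw [sub_zero, max_eq_left (h.nonneg x)]
  have hWB : W 0 ≤ ∑ x ∈ B, m x :=
    Finset.sum_le_sum_of_subset_of_nonneg (Finset.filter_subset _ _) fun x _ _ => hm0 x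
  rw [hF0] at h0
  have := mul_le_mul_of_nonneg_left hWB (by positivity : 0 ≤ 2 * s)
  rw [hs] at this h0
  linarith

end IsGreenSubsolution

/-! ### The walk killed on leaving a set -/

/-- The probability that the walk stays in `B` up to time `k` and is then at `y`. -/
noncomputable def killedMass {d : ℕ} (ω : Environment d) (o : Fin d → ℤ) (B : Set (Fin d → ℤ))
    (k : ℕ) (y : Fin d → ℤ) : ℝ≥0∞ :=
  walkLaw ω o {X | (∀ j ≤ k, X j ∈ B) ∧ X k = y}

section Walk

variable {d : ℕ} (ω : Environment d) (o : Fin d → ℤ) (B : Set (Fin d → ℤ))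

instance : IsProbabilityMeasure (walkLaw ω o) := by
  unfold walkLaw; infer_instance

lemma measurableSet_stay (k : ℕ) :
    MeasurableSet {X : ℕ → Fin d → ℤ | ∀ j ≤ k, X j ∈ B} := by
  have : {X : ℕ → Fin d → ℤ | ∀ j ≤ k, X j ∈ B} = ⋂ j, ⋂ (_ : j ≤ k), (fun X => X j) ⁻¹' B := by
    ext; simp
  rw [this]
  exact MeasurableSet.iInter fun j => MeasurableSet.iInter fun _ =>
    measurable_pi_apply j (B.to_countable.measurableSet)

lemma killedMass_of_notMem {k : ℕ} {y : Fin d → ℤ} (hy : y ∉ B) : killedMass ω o B k y = 0 := by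
  have : {X : ℕ → Fin d → ℤ | (∀ j ≤ k, X j ∈ B) ∧ X k = y} = ∅ := by
    ext X
    simp only [Set.mem_ofPred_eq, Set.mem_empty_iff_false, iff_false]
    rintro ⟨h1, rfl⟩
    exact hy (h1 k le_rfl)
  rw [killedMass, this, measure_empty]

lemma killedMass_ne_top (k : ℕ) (y : Fin d → ℤ) : killedMass ω o B k y ≠ ∞ :=
  measure_ne_top _ _

/-- Integrals over the event that the walk stays in `B` up to time `k`. -/
lemma lintegral_stay (k : ℕ) (f : (Fin d → ℤ) → ℝ≥0∞) :
    ∫⁻ X in {X | ∀ j ≤ k, X j ∈ B}, f (X k) ∂walkLaw ω o = ∑' x, f x * killedMass ω o B k x := by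
  have hk : Measurable fun X : ℕ → Fin d → ℤ => X k := measurable_pi_apply k
  rw [← lintegral_map (measurable_of_countable f) hk, lintegral_countable']
  refine tsum_congr fun x => ?_
  rw [Measure.map_apply hk (measurableSet_singleton x), Measure.restrict_apply
    (hk (measurableSet_singleton x)), killedMass]
  congr 2
  ext X
  simp [and_comm]

lemma killedMass_zero (y : Fin d → ℤ) : killedMass ω o B 0 y ≤ if y = o then 1 else 0 := by
  split_ifs with h
  · exact prob_le_one
  · have h0 : (walkLaw ω o).map (Preorder.frestrictLe 0) = Measure.dirac (fun _ => o) := by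
      rw [walkLaw, Kernel.traj_map_frestrictLe_apply, Kernel.partialTraj_self, Kernel.id_apply]
    have hmeas : MeasurableSet {z : (i : Finset.Iic 0) → (fun _ : ℕ => Fin d → ℤ) i |
        z ⟨0, by simp⟩ = y} := by
      have hev : Measurable fun z : (i : Finset.Iic 0) → (fun _ : ℕ => Fin d → ℤ) i =>
        z ⟨0, by simp⟩ := measurable_pi_apply _
      exact hev (measurableSet_singleton y)
    refine (measure_mono (t := Preorder.frestrictLe 0 ⁻¹'
      {z : (i : Finset.Iic 0) → (fun _ : ℕ => Fin d → ℤ) i | z ⟨0, by simp⟩ = y})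
      fun X hX => hX.2).trans ?_
    rw [← Measure.map_apply (Preorder.measurable_frestrictLe 0) hmeas, h0,
      Measure.dirac_apply' _ hmeas]
    simp [Ne.symm h]

/-- The Markov property for the killed walk. -/
lemma killedMass_succ (k : ℕ) {y : Fin d → ℤ} (hy : y ∈ B) :
    killedMass ω o B (k + 1) y = ∑' x, stepPMF ω x y * killedMass ω o B k x := by
  rw [← lintegral_stay ω o B k fun x => stepPMF ω x y]
  set S : Set ((i : Finset.Iic k) → (fun _ : ℕ => Fin d → ℤ) i) := {z | ∀ i, z i ∈ B} with hS
  have hSm : MeasurableSet S := by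
    have : S = ⋂ i, (fun z => z i) ⁻¹' B := by ext; simp [hS]
    rw [this]
    exact MeasurableSet.iInter fun i => measurable_pi_apply i (B.to_countable.measurableSet)
  have hpre : Preorder.frestrictLe k ⁻¹' S = {X : ℕ → Fin d → ℤ | ∀ j ≤ k, X j ∈ B} := by
    ext X
    simp [hS, Preorder.frestrictLe]
  have hset : {X : ℕ → Fin d → ℤ | (∀ j ≤ k + 1, X j ∈ B) ∧ X (k + 1) = y} =
      (fun X => (Preorder.frestrictLe k X, X (k + 1))) ⁻¹' (S ×ˢ {y}) := by
    ext X
    have h1 : X ∈ Preorder.frestrictLe k ⁻¹' S ↔ ∀ j ≤ k, X j ∈ B := by rw [hpre]; rfl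
    change _ ↔ X ∈ Preorder.frestrictLe k ⁻¹' S ∧ X (k + 1) = y
    rw [h1]
    refine ⟨fun h => ⟨fun j hj => h.1 j (by omega), h.2⟩, fun h => ⟨fun j hj => ?_, h.2⟩⟩
    rcases Nat.le_succ_iff.1 hj with h' | rfl
    · exact h.1 j h'
    · exact h.2 ▸ hy
  -- The joint law of the path up to time `k` and the next position is the composition product with
  -- the step kernel.
  have hjoint := Kernel.partialTraj_compProd_eq_map_traj (X := fun _ : ℕ => Fin d → ℤ)
    (κ := historyKernel ω) (Nat.zero_le k) (x₀ := fun _ => o)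
  have hker : ∀ z : (i : Finset.Iic k) → (fun _ : ℕ => Fin d → ℤ) i,
      historyKernel ω k z {y} = stepPMF ω (z ⟨k, Finset.mem_Iic.2 le_rfl⟩) y := fun z => by
    rw [historyKernel, Kernel.comap_apply]
    exact PMF.toMeasure_apply_singleton _ _ (measurableSet_singleton y)
  have hmeas : Measurable fun X : ℕ → Fin d → ℤ =>
      (Preorder.frestrictLe (π := fun _ => Fin d → ℤ) k X, X (k + 1)) :=
    (Preorder.measurable_frestrictLe k).prodMk (measurable_pi_apply _)
  rw [killedMass, hset, ← Measure.map_apply hmeas (hSm.prod (measurableSet_singleton y)), walkLaw,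
    ← hjoint, Measure.compProd_apply_prod hSm (measurableSet_singleton y)]
  simp_rw [hker]
  have hf : Measurable fun a : (i : Finset.Iic k) → (fun _ : ℕ => Fin d → ℤ) i =>
      stepPMF ω (a ⟨k, Finset.mem_Iic.2 le_rfl⟩) y := by
    have hev : Measurable fun z : (i : Finset.Iic k) → (fun _ : ℕ => Fin d → ℤ) i =>
      z ⟨k, Finset.mem_Iic.2 le_rfl⟩ := measurable_pi_apply _
    exact (measurable_of_countable fun x => stepPMF ω x y).comp hev
  rw [← Kernel.traj_map_frestrictLe_apply, setLIntegral_map hSm hf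
    (Preorder.measurable_frestrictLe k), hpre]
  rfl

/-- Each time before the exit contributes 1; if the trajectory never leaves, the series diverges. -/
lemma exitTime_le_tsum (X : ℕ → Fin d → ℤ) :
    exitTime B X ≤ ∑' k : ℕ, {X : ℕ → Fin d → ℤ | ∀ j ≤ k, X j ∈ B}.indicator 1 X := by
  classical
  by_cases hex : ∃ k, X k ∉ B
  · refine (iInf₂_le (Nat.find hex) (Nat.find_spec hex)).trans ?_
    refine le_trans ?_ (ENNReal.sum_le_tsum (Finset.range (Nat.find hex)))
    rw [Finset.sum_congr rfl (g := fun _ => (1 : ℝ≥0∞))]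
    · simp
    · intro k hk
      refine Set.indicator_of_mem (fun j hj => ?_) _
      by_contra hjB
      exact Nat.find_min hex (lt_of_le_of_lt hj (Finset.mem_range.1 hk)) hjB
  · push Not at hex
    have : ∀ k : ℕ, {X : ℕ → Fin d → ℤ | ∀ j ≤ k, X j ∈ B}.indicator
        (1 : (ℕ → Fin d → ℤ) → ℝ≥0∞) X = 1 := fun k => by
      rw [Set.indicator_of_mem (show X ∈ {X : ℕ → Fin d → ℤ | ∀ j ≤ k, X j ∈ B} from
        fun j _ => hex j), Pi.one_apply]
    simp_rw [this]
    rw [ENNReal.tsum_const_eq_top_of_ne_zero one_ne_zero]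
    exact le_top

lemma expectedExitTime_le_tsum :
    expectedExitTime ω o B ≤ ∑' k, ∑' y, killedMass ω o B k y := by
  refine (lintegral_mono (exitTime_le_tsum B)).trans ?_
  rw [lintegral_tsum fun k => (measurable_one.indicator (measurableSet_stay B k)).aemeasurable]
  refine ENNReal.tsum_le_tsum fun k => ?_
  rw [lintegral_indicator_one (measurableSet_stay B k)]
  have := lintegral_stay ω o B k 1
  simp only [Pi.one_apply, lintegral_one, one_mul, Measure.restrict_apply_univ] at this
  exact this.le

end Walk

/-! ### Truncated Green functions on the square lattice -/

/-- The four neighbours of a vertex of the square lattice. -/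
def latticeNeighbors (x : Fin 2 → ℤ) : Finset (Fin 2 → ℤ) :=
  Finset.univ.image (fun b => x + unitVec b) ∪ Finset.univ.image (fun b => x - unitVec b)

lemma mem_latticeNeighbors {x y : Fin 2 → ℤ} :
    y ∈ latticeNeighbors x ↔ (latticeGraph 2).Adj x y := by
  simp only [latticeNeighbors, Finset.mem_union, Finset.mem_image, Finset.mem_univ, true_and,
    latticeGraph_adj_iff, ← exists_or]
  refine exists_congr fun b => ?_
  rw [eq_comm, sub_eq_iff_eq_add]

lemma card_latticeNeighbors_le (x : Fin 2 → ℤ) : (latticeNeighbors x).card ≤ 4 :=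
  (Finset.card_union_le _ _).trans
    (add_le_add Finset.card_image_le Finset.card_image_le)

lemma conductance_of_not_adj {d : ℕ} (ω : Environment d) {x y : Fin d → ℤ}
    (h : ¬(latticeGraph d).Adj x y) : conductance ω x y = 0 := dif_neg h

lemma conductance_pos {d : ℕ} {ω : Environment d} (hω : ∀ e, 0 < ω e) {x y : Fin d → ℤ}
    (h : (latticeGraph d).Adj x y) : 0 < conductance ω x y := by
  rw [conductance, dif_pos h]; exact hω _

lemma toReal_vertexWeight (ω : Environment 2) {x : Fin 2 → ℤ} {Λ : Finset (Fin 2 → ℤ)}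
    (hΛ : ∀ y, (latticeGraph 2).Adj x y → y ∈ Λ) :
    (vertexWeight ω x).toReal = ∑ y ∈ Λ, (conductance ω x y : ℝ) := by
  rw [vertexWeight, tsum_eq_sum (s := Λ)]
  · rw [ENNReal.toReal_sum fun _ _ => ENNReal.coe_ne_top]; rfl
  · intro y hy
    rw [conductance_of_not_adj ω fun h => hy (hΛ y h), ENNReal.coe_zero]

lemma sum_conductance_le (ω : Environment 2) {M : ℝ≥0} (hM : ∀ e, ω e ≤ M) (x : Fin 2 → ℤ)
    (Λ : Finset (Fin 2 → ℤ)) : ∑ y ∈ Λ, (conductance ω x y : ℝ) ≤ 4 * M := by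
  have hle : ∀ y, (conductance ω x y : ℝ) ≤ M := fun y => by
    rw [conductance]
    split_ifs
    · exact_mod_cast hM _
    · simp
  calc ∑ y ∈ Λ, (conductance ω x y : ℝ) ≤ ∑ y ∈ Λ ∩ latticeNeighbors x, (conductance ω x y : ℝ) := by
        refine le_of_eq (Finset.sum_subset Finset.inter_subset_left fun y hy hy' => ?_).symm
        rw [conductance_of_not_adj ω fun h =>
          hy' (Finset.mem_inter.2 ⟨hy, mem_latticeNeighbors.2 h⟩), NNReal.coe_zero]
    _ ≤ (Λ ∩ latticeNeighbors x).card • (M : ℝ) := Finset.sum_le_card_nsmul _ _ _ fun y _ => hle y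
    _ ≤ 4 * M := by
        rw [nsmul_eq_mul]
        gcongr
        exact_mod_cast (Finset.card_le_card Finset.inter_subset_right).trans
          (card_latticeNeighbors_le x)

lemma vertexWeight_pos {ω : Environment 2} (hω : ∀ e, 0 < ω e) (x : Fin 2 → ℤ) :
    0 < vertexWeight ω x := by
  refine lt_of_lt_of_le ?_ (ENNReal.le_tsum (x + unitVec 0))
  exact_mod_cast conductance_pos hω (latticeGraph_adj_add x 0)

lemma stepPMF_apply {ω : Environment 2} (hω : ∀ e, 0 < ω e) (x y : Fin 2 → ℤ) :
    stepPMF ω x y = conductance ω x y * (vertexWeight ω x)⁻¹ := by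
  rw [stepPMF, dif_neg (vertexWeight_pos hω x).ne', PMF.normalize_apply]; rfl

/-- The density of the expected number of visits before time `n` of the walk from `o` killed on
leaving `B`. -/
noncomputable def truncatedGreen {d : ℕ} (ω : Environment d) (o : Fin d → ℤ) (B : Set (Fin d → ℤ))
    (n : ℕ) (y : Fin d → ℤ) : ℝ :=
  (∑ k ∈ Finset.range n, (killedMass ω o B k y).toReal) / (vertexWeight ω y).toReal

/-- A finite set of vertices together with its neighbours. -/
def neighborClosure (B : Finset (Fin 2 → ℤ)) : Finset (Fin 2 → ℤ) :=
  B ∪ B.biUnion latticeNeighbors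

lemma subset_neighborClosure (B : Finset (Fin 2 → ℤ)) : B ⊆ neighborClosure B :=
  Finset.subset_union_left

lemma mem_neighborClosure_of_adj {B : Finset (Fin 2 → ℤ)} {x y : Fin 2 → ℤ} (hx : x ∈ B)
    (h : (latticeGraph 2).Adj x y) : y ∈ neighborClosure B :=
  Finset.mem_union_right _ (Finset.mem_biUnion.2 ⟨x, hx, mem_latticeNeighbors.2 h⟩)

/-- Reversibility turns the forward equation for the killed mass into a Laplace equation for its
density, and the sum over time telescopes. Truncating in time keeps everything finite without prior
knowledge of the exit time; the final mass has the right sign and is dropped. -/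
lemma isGreenSubsolution_truncatedGreen {ω : Environment 2} (hω : ∀ e, 0 < ω e)
    (B : Finset (Fin 2 → ℤ)) (o : Fin 2 → ℤ) (n : ℕ) :
    IsGreenSubsolution (latticeGraph 2).Adj (fun x y => (conductance ω x y : ℝ))
      (neighborClosure B) B o (truncatedGreen ω o B n) where
  rel_symm _ _ h := h.symm
  cond_symm x y := by rw [conductance_comm]
  cond_nonneg _ _ := NNReal.coe_nonneg _
  cond_pos _ _ h := NNReal.coe_pos.2 (conductance_pos hω h)
  cond_zero _ _ h := by rw [conductance_of_not_adj ω h, NNReal.coe_zero]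
  subset := subset_neighborClosure B
  neighbor_mem _ hx _ h := mem_neighborClosure_of_adj hx h
  nonneg _ := div_nonneg (Finset.sum_nonneg fun _ _ => ENNReal.toReal_nonneg)
    ENNReal.toReal_nonneg
  eq_zero x hx := by
    have : ∀ k, killedMass ω o B k x = 0 := fun k => killedMass_of_notMem ω o B (by simpa using hx)
    simp [truncatedGreen, this]
  laplacian_le y hy := by
    set w : (Fin 2 → ℤ) → ℝ := fun x => (vertexWeight ω x).toReal with hw
    have hw0 : ∀ x, 0 < w x := fun x =>
      ENNReal.toReal_pos (vertexWeight_pos hω x).ne' (vertexWeight_ne_top ω x)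
    set q : ℕ → (Fin 2 → ℤ) → ℝ := fun k x => (killedMass ω o B k x).toReal with hq
    have hq0 : ∀ k x, 0 ≤ q k x := fun _ _ => ENNReal.toReal_nonneg
    have hqB : ∀ k, ∀ x ∉ B, killedMass ω o B k x = 0 := fun k x hx =>
      killedMass_of_notMem ω o B (by simpa using hx)
    have hrec : ∀ k, q (k + 1) y = ∑ x ∈ B, conductance ω x y * (w x)⁻¹ * q k x := by
      intro k
      simp only [hq]
      rw [killedMass_succ ω o B k (Finset.mem_coe.2 hy), tsum_eq_sum (s := B) fun x hx => by
        rw [hqB k x hx, mul_zero]]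
      rw [ENNReal.toReal_sum fun x _ => ENNReal.mul_ne_top (PMF.apply_ne_top _ _)
        (killedMass_ne_top ω o B k x)]
      refine Finset.sum_congr rfl fun x _ => ?_
      rw [ENNReal.toReal_mul, stepPMF_apply hω, ENNReal.toReal_mul, ENNReal.toReal_inv]
      rfl
    have hzero : q 0 y ≤ if y = o then 1 else 0 := by
      have := ENNReal.toReal_mono (by split_ifs <;> simp) (killedMass_zero ω o B y)
      refine this.trans_eq ?_
      split_ifs <;> simp
    have hg : ∀ x, truncatedGreen ω o B n x = (∑ k ∈ Finset.range n, q k x) / w x := fun _ => rfl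
    have hleft : (∑ x ∈ neighborClosure B, (conductance ω y x : ℝ)) * truncatedGreen ω o B n y
        = ∑ k ∈ Finset.range n, q k y := by
      rw [← toReal_vertexWeight ω fun x => mem_neighborClosure_of_adj hy, hg,
        mul_div_cancel₀ _ (hw0 y).ne']
    have hright : ∑ x ∈ neighborClosure B, (conductance ω y x : ℝ) * truncatedGreen ω o B n x
        = ∑ k ∈ Finset.range n, q (k + 1) y := by
      rw [← Finset.sum_subset (subset_neighborClosure B)]
      · simp_rw [hrec]
        rw [Finset.sum_comm]
        refine Finset.sum_congr rfl fun x _ => ?_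
        rw [hg, ← Finset.mul_sum, conductance_comm ω y x]
        ring
      · intro x _ hx
        simp [truncatedGreen, hqB _ x hx]
    rw [hleft, hright]
    calc ∑ k ∈ Finset.range n, q k y ≤ ∑ k ∈ Finset.range (n + 1), q k y :=
          Finset.sum_le_sum_of_subset_of_nonneg (Finset.range_mono n.le_succ)
            fun k _ _ => hq0 k y
      _ = (∑ k ∈ Finset.range n, q (k + 1) y) + q 0 y := Finset.sum_range_succ' _ _
      _ ≤ _ := by linarith

/-- A uniform bound on the truncated Green functions bounds the expected exit time. -/
lemma expectedExitTime_le_of_truncatedGreen {ω : Environment 2} (hω : ∀ e, 0 < ω e)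
    (B : Finset (Fin 2 → ℤ)) (o : Fin 2 → ℤ) {b : ℝ}
    (hb : ∀ n, ∑ x ∈ B, (∑ y ∈ neighborClosure B, (conductance ω x y : ℝ)) *
      truncatedGreen ω o B n x ≤ b) :
    expectedExitTime ω o B ≤ ENNReal.ofReal b := by
  refine (expectedExitTime_le_tsum ω o B).trans (ENNReal.tsum_le_of_sum_range_le fun n => ?_)
  have hfin : ∀ k, ∑' y, killedMass ω o B k y = ∑ y ∈ B, killedMass ω o B k y := fun k =>
    tsum_eq_sum fun x hx => killedMass_of_notMem ω o B (by simpa using hx)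
  simp_rw [hfin]
  rw [Finset.sum_comm]
  have hne : ∑ y ∈ B, ∑ k ∈ Finset.range n, killedMass ω o B k y ≠ ∞ :=
    ENNReal.sum_ne_top.2 fun y _ => ENNReal.sum_ne_top.2 fun k _ => killedMass_ne_top ω o B k y
  rw [ENNReal.le_ofReal_iff_toReal_le hne]
  · rw [ENNReal.toReal_sum fun y _ => ENNReal.sum_ne_top.2 fun k _ => killedMass_ne_top ω o B k y]
    refine le_trans (le_of_eq (Finset.sum_congr rfl fun x hx => ?_)) (hb n)
    rw [ENNReal.toReal_sum fun k _ => killedMass_ne_top ω o B k x,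
      ← toReal_vertexWeight ω fun y => mem_neighborClosure_of_adj hx, truncatedGreen,
      mul_div_cancel₀]
    exact (ENNReal.toReal_pos (vertexWeight_pos hω x).ne' (vertexWeight_ne_top ω x)).ne'
  · refine le_trans (Finset.sum_nonneg fun x _ => mul_nonneg ?_ ?_) (hb 0)
    · exact Finset.sum_nonneg fun y _ => NNReal.coe_nonneg _
    · simp [truncatedGreen]

lemma volumeOf_finset (ω : Environment 2) (B : Finset (Fin 2 → ℤ)) :
    volumeOf ω (B : Set (Fin 2 → ℤ)) =
      ENNReal.ofReal (∑ x ∈ B, ∑ y ∈ neighborClosure B, (conductance ω x y : ℝ)) := by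
  have h : volumeOf ω (B : Set (Fin 2 → ℤ)) = ∑ x ∈ B, vertexWeight ω x :=
    Finset.tsum_subtype' B (vertexWeight ω)
  rw [h, ENNReal.ofReal_sum_of_nonneg fun x _ => Finset.sum_nonneg fun y _ => NNReal.coe_nonneg _]
  refine Finset.sum_congr rfl fun x hx => ?_
  rw [← toReal_vertexWeight ω fun y => mem_neighborClosure_of_adj hx,
    ENNReal.ofReal_toReal (vertexWeight_ne_top ω x)]

/-- Under the isoperimetric inequality an infinite connected set has infinite volume. -/
lemma volumeOf_eq_top_of_infinite {ω : Environment 2} {K : ℝ} {n : ℕ}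
    (hK : 0 < K)
    (hiso : ∀ A Λ : Finset (Fin 2 → ℤ), 0 ∈ A →
      CutConnected (latticeGraph 2).Adj (A : Set (Fin 2 → ℤ)) →
      (∀ x ∈ A, ∀ y, (latticeGraph 2).Adj x y → y ∈ Λ) → n ≤ A.card →
      (A.card : ℝ) ≤ K * (∑ x ∈ A, ∑ y ∈ Λ \ A, (conductance ω x y : ℝ)) ^ 2)
    {B : Set (Fin 2 → ℤ)} (h0 : 0 ∈ B) (hB : CutConnected (latticeGraph 2).Adj B)
    (hinf : B.Infinite) : volumeOf ω B = ∞ := by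
  by_contra htop
  obtain ⟨k, hk⟩ := exists_nat_gt (K * (volumeOf ω B).toReal ^ 2)
  -- `n` makes the isoperimetric inequality available, while `k` exceeds the bound it gives on |A|,
  -- since the cut is at most the volume of `B`.
  obtain ⟨A, hAB, h0A, hA, hcard⟩ := hB.exists_finset (fun _ _ h => h.symm) hinf h0 (max k n)
  have h1 := hiso A (neighborClosure A) h0A hA (fun x hx y h => mem_neighborClosure_of_adj hx h)
    (by rw [hcard]; omega)
  have h2 : ∑ x ∈ A, ∑ y ∈ neighborClosure A \ A, (conductance ω x y : ℝ)
      ≤ (volumeOf ω B).toReal := by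
    refine (Finset.sum_le_sum fun x _ => Finset.sum_le_sum_of_subset_of_nonneg
      Finset.sdiff_subset fun _ _ _ => NNReal.coe_nonneg _).trans ?_
    rw [← ENNReal.ofReal_le_iff_le_toReal htop, ← volumeOf_finset]
    exact ENNReal.tsum_mono_subtype _ hAB
  have h3 : ((A.card : ℕ) : ℝ) ≤ K * (volumeOf ω B).toReal ^ 2 := by
    refine h1.trans ?_
    have : 0 ≤ ∑ x ∈ A, ∑ y ∈ neighborClosure A \ A, (conductance ω x y : ℝ) :=
      Finset.sum_nonneg fun x _ => Finset.sum_nonneg fun y _ => NNReal.coe_nonneg _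
    gcongr
  have h4 : (k : ℝ) ≤ A.card := by
    rw [hcard]; exact_mod_cast (le_max_left k n).trans (Nat.le_succ _)
  linarith

/-! ### Conclusion -/

lemma exists_pos_le_of_lt (f : ℕ → ℝ) (hf : ∀ i, 0 < f i) (n : ℕ) :
    ∃ κ, 0 < κ ∧ ∀ i < n, κ ≤ f i := by
  induction n with
  | zero => exact ⟨1, one_pos, by simp⟩
  | succ n ih =>
    obtain ⟨κ, hκ, h⟩ := ih
    refine ⟨min κ (f n), lt_min hκ (hf n), fun i hi => ?_⟩
    rcases Nat.lt_succ_iff_lt_or_eq.1 hi with h' | rfl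
    · exact (min_le_left _ _).trans (h i h')
    · exact min_le_right _ _

/-- A rightmost vertex has its right neighbour outside. This is the input to the maximum principle.
-/
lemma exists_adj_notMem (T : Finset (Fin 2 → ℤ)) (hT : T.Nonempty) :
    ∃ x ∈ T, ∃ y, y ∉ T ∧ (latticeGraph 2).Adj x y := by
  obtain ⟨x, hx, hmax⟩ := T.exists_max_image (fun x => x 0) hT
  refine ⟨x, hx, x + unitVec 0, fun h => ?_, latticeGraph_adj_add x 0⟩
  have := hmax _ h
  simp at this

theorem propositionp2 (Q : Measure (Environment 2)) [IsProbabilityMeasure Q]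
    (hindep : iIndepFun (fun e (ω : Environment 2) => ω e) Q)
    (hident : ∀ e e', IdentDistrib (fun ω : Environment 2 => ω e) (fun ω => ω e') Q Q)
    (hpos : ∀ e, ∀ᵐ ω ∂Q, 0 < ω e)
    (hbdd : ∃ M : ℝ≥0, ∀ e, ∀ᵐ ω ∂Q, ω e ≤ M) :
    ∃ C : ℝ≥0, 0 < C ∧ ∀ᵐ ω ∂Q, ∃ N : ℝ≥0, ∀ B : Set (Fin 2 → ℤ),
      0 ∈ B → ((latticeGraph 2).induce B).Connected → (N : ℝ≥0∞) ≤ volumeOf ω B →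
        expectedExitTime ω 0 B ≤ C * volumeOf ω B := by
  obtain ⟨M, hM⟩ := hbdd
  obtain ⟨K, hK, hae⟩ := ae_isoperimetric Q hindep hident hpos
  -- Four edges per vertex bound the weight by 4M; the extra 1 ensures positivity.
  set M' : ℝ := 4 * M + 1 with hM'
  have hM'0 : 0 < M' := by positivity
  have hC0 : 0 < 8 * M' * K + 1 := by positivity
  refine ⟨(8 * M' * K + 1).toNNReal, Real.toNNReal_pos.2 hC0, ?_⟩
  filter_upwards [hae, ae_all_iff.2 hpos, ae_all_iff.2 hM] with ω ⟨n, hiso⟩ hω hωM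
  let p : ℕ → Fin 2 → ℤ := fun i => ![(i : ℤ), 0]
  have hadj : ∀ i, (latticeGraph 2).Adj (p i) (p (i + 1)) := fun i => by
    have := latticeGraph_adj_add (p i) 0
    rw [vec_add_unitVec_zero] at this
    simpa [p] using this
  have hp : Function.Injective p := fun i j hij => by
    have := congrFun hij 0
    simpa [p] using this
  obtain ⟨κ, hκ, hcond⟩ := exists_pos_le_of_lt (fun i => (conductance ω (p i) (p (i + 1)) : ℝ))
    (fun i => NNReal.coe_pos.2 (conductance_pos hω (hadj i))) n
  set c₀ : ℝ := M' * n * (2 * n ^ 2 / κ) with hc₀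
  have hc₀0 : 0 ≤ c₀ := by positivity
  -- `n` and `κ` depend on the environment but enter only `c₀`. Once the volume exceeds `c₀`, this
  -- term is absorbed by the `+ 1` in the constant.
  refine ⟨c₀.toNNReal, fun B h0 hconn hN => ?_⟩
  rcases B.finite_or_infinite with hfin | hinf
  · obtain ⟨B, rfl⟩ := hfin.exists_finset_coe
    set v : ℝ := ∑ x ∈ B, ∑ y ∈ neighborClosure B, (conductance ω x y : ℝ) with hv
    have hv0 : 0 ≤ v := Finset.sum_nonneg fun x _ => Finset.sum_nonneg fun y _ =>
      NNReal.coe_nonneg _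
    rw [volumeOf_finset] at hN ⊢
    have hcv : c₀ ≤ v := (ENNReal.ofReal_le_ofReal_iff hv0).1 hN
    have hbound := expectedExitTime_le_of_truncatedGreen hω B 0 (b := 8 * M' * K * v + c₀)
      fun k => (isGreenSubsolution_truncatedGreen hω B 0 k).sum_le exists_adj_notMem hK hM'0 hκ
        (fun x => (sum_conductance_le ω hωM x _).trans (by linarith))
        (fun A hAB h0A hA hcard => hiso A _ h0A hA
          (fun x hx y h => mem_neighborClosure_of_adj (hAB hx) h) hcard)
        hp (by ext i; fin_cases i <;> rfl) hadj hcond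
    refine hbound.trans ?_
    rw [← ENNReal.ofReal, ← ENNReal.ofReal_mul hC0.le]
    exact ENNReal.ofReal_le_ofReal (by linarith)
  · rw [volumeOf_eq_top_of_infinite hK hiso h0 (cutConnected_of_induce hconn) hinf,
      ENNReal.mul_top (by simpa using hC0)]
    exact le_top
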